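/- Let $d\in\mathbb N$, let $\Omega\subset\mathbb R^d$ be a bounded domain (open, connected, non-empty) with $C^\infty$ boundary and outward unit normal $\nu$, and suppose $0\in\overline\Omega$. Let $T>0$, $Q=\Omega\times(0,T)$, and let $H\in C^1([0,T];\mathbb R^d)$ satisfy $H_0:=\min_{t\in[0,T]}|H(t)|>0$. For $u\in H^1(Q)$ (real-valued) put $Pu:=\partial_t u+H(t)\cdot\nabla u$. Fix $S_*\in(1/\sqrt2,1)$ and $r>0$, and let $0=t_0<t_1<\dots<t_m=T$ be a partition such that, with $\eta_j:=H(t_j)/|H(t_j)|$, $$\frac{H(t)}{|H(t)|}\cdot\eta_j\ \ge\ S_*\qquad\text{for all } t\in[t_j,t_{j+1}],\ j=0,\dots,m-1 .$$ Let $\delta_\Omega=\operatorname{diam}\Omega$, $R_0=\frac{1+S_*}{1-S_*}\delta_\Omega$, $R_j=2^jR_0+(2^j-1)(\delta_\Omega+r)$ and $x_j=-R_j\eta_j$ for $j=0,\dots,m-1$. Let $\beta=(2S_*^2-1)\,H_0\,\min_{x\in\overline\Omega}|x-x_0|$, and define $$\varphi(x,t)=\varphi_j(x,t):=-\beta(t-t_j)+|x-x_j|^2\qquad\text{for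 } x\in\overline\Omega,\ t\in[t_j,t_{j+1}),\ j=0,\dots,m-1 .$$ Let $\Sigma=\{(x,t)\in\partial\Omega\times(0,T): H(t)\cdot\nu(x)\ge0\}$ and let $d\gamma$ be the surface measure on $\partial\Omega$. Then there exist constants $s_0,C_0,C>0$, independent of $u$ and of $s$, such that for every $u\in H^1(Q)$ and every $s>s_0$, $$s^2\int_Q|u|^2e^{2s\varphi}\,dx\,dt+s\,e^{-C_0s}\sum_{j=0}^{m-1}\int_\Omega|u(x,t_j)|^2\,dx$$ $$\le\ C\int_Q|Pu|^2e^{2s\varphi}\,dx\,dt+C\,s\,e^{Cs}\int_\Sigma|u|^2\,d\gamma\,dt+C\,s\,e^{Cs}\int_\Omega|u(x,T)|^2\,dx .$$ Here $u$ on $\Sigma$ is the trace of $u$ on $\partial\Omega\times(0,T)$, and $u(\cdot,t)$, $t\in[0,T]$, is the time slice of the representative of $u$ in $C([0,T];L^2(\Omega))$. -/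

import Mathlib

open Set Filter Topology MeasureTheory
open scoped ContDiff

noncomputable section

/-- The space `ℝ^d` with its Euclidean norm and inner product. -/
abbrev RSpace (d : ℕ) : Type := EuclideanSpace ℝ (Fin d)

/-! ### The domain, its boundary, the unit normal and the lateral surface measure -/

/-- `ρ` is a smooth local defining function of `Ω` near `p`: its gradient does not vanish at `p`
and, near `p`, the set `Ω` is exactly `{ρ < 0}`. -/
def IsDefiningFunctionAt {d : ℕ} (Ω : Set (RSpace d)) (p : RSpace d) (ρ : RSpace d → ℝ) : Prop :=
  ContDiff ℝ ∞ ρ ∧ gradient ρ p ≠ 0 ∧ ∀ᶠ x in 𝓝 p, x ∈ Ω ↔ ρ x < 0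

/-- `Ω` lies locally on one side of its boundary, which is a smooth hypersurface. -/
def HasSmoothBoundary {d : ℕ} (Ω : Set (RSpace d)) : Prop :=
  ∀ p ∈ frontier Ω, ∃ ρ : RSpace d → ℝ, IsDefiningFunctionAt Ω p ρ

/-- A bounded domain (open, connected, non-empty) of `ℝ^d` with smooth boundary. -/
structure IsSmoothBoundedDomain {d : ℕ} (Ω : Set (RSpace d)) : Prop where
  isOpen : IsOpen Ω
  isConnected : IsConnected Ω
  isBounded : Bornology.IsBounded Ω
  smooth : HasSmoothBoundary Ω

open Classical in
/-- The outward unit normal `ν(p) = ∇ρ(p) / |∇ρ(p)|` at a boundary point `p`, where `ρ` is any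
local defining function of `Ω` near `p` (the value does not depend on which one is chosen). -/
def outwardNormal {d : ℕ} (Ω : Set (RSpace d)) (p : RSpace d) : RSpace d :=
  if h : ∃ ρ : RSpace d → ℝ, IsDefiningFunctionAt Ω p ρ then
    ‖gradient h.choose p‖⁻¹ • gradient h.choose p
  else 0

/-- The space-time cylinder `Q = Ω × (0, T)`. -/
def spaceTimeCylinder {d : ℕ} (Ω : Set (RSpace d)) (T : ℝ) : Set (RSpace d × ℝ) := Ω ×ˢ Ioo 0 T

/-- The measure `dγ dt` on the lateral boundary `∂Ω × (0, T)`: surface measure on `∂Ω`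
(the `(d-1)`-dimensional Hausdorff measure with Euclidean normalization) times Lebesgue measure. -/
def lateralMeasure {d : ℕ} (Ω : Set (RSpace d)) (T : ℝ) : Measure (RSpace d × ℝ) :=
  ((Measure.euclideanHausdorffMeasure (d - 1) : Measure (RSpace d)).restrict (frontier Ω)).prod
    ((volume : Measure ℝ).restrict (Ioo 0 T))

/-- The exit subboundary `Σ = {(x, t) ∈ ∂Ω × (0, T) : H(t) · ν(x) ≥ 0}`. -/
def exitBoundary {d : ℕ} (Ω : Set (RSpace d)) (T : ℝ) (H : ℝ → RSpace d) :
    Set (RSpace d × ℝ) :=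
  {z | z.1 ∈ frontier Ω ∧ z.2 ∈ Ioo 0 T ∧ 0 ≤ inner ℝ (H z.2) (outwardNormal Ω z.1)}

/-! ### The Sobolev space `H¹(Q)` and traces -/

/-- `u ∈ H¹(Q)`, with weak time derivative `ut` and weak spatial gradient `Du`, both in `L²(Q)`. -/
structure IsH1WithDerivs {d : ℕ} (Q : Set (RSpace d × ℝ)) (u ut : RSpace d × ℝ → ℝ)
    (Du : RSpace d × ℝ → RSpace d) : Prop where
  memLp : MemLp u 2 (volume.restrict Q)
  memLp_time : MemLp ut 2 (volume.restrict Q)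
  memLp_space : MemLp Du 2 (volume.restrict Q)
  weak_time : ∀ ψ : RSpace d × ℝ → ℝ, ContDiff ℝ ∞ ψ → HasCompactSupport ψ → tsupport ψ ⊆ Q →
    ∫ z in Q, u z * fderiv ℝ ψ z (0, 1) = - ∫ z in Q, ut z * ψ z
  weak_space : ∀ ψ : RSpace d × ℝ → ℝ, ContDiff ℝ ∞ ψ → HasCompactSupport ψ → tsupport ψ ⊆ Q →
    ∀ a : RSpace d,
      ∫ z in Q, u z * fderiv ℝ ψ z (a, 0) = - ∫ z in Q, inner ℝ (Du z) a * ψ z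

/-- `Pu = ∂ₜu + H(t) · ∇u`, in terms of the weak derivatives `ut` and `Du` of `u`. -/
def transportOp {d : ℕ} (H : ℝ → RSpace d) (ut : RSpace d × ℝ → ℝ)
    (Du : RSpace d × ℝ → RSpace d) (z : RSpace d × ℝ) : ℝ :=
  ut z + inner ℝ (H z.2) (Du z)

/-- The functions `v n`, smooth up to the boundary of the bounded set `Q`, converge in `H¹(Q)` to
the function `u` with weak derivatives `ut` and `Du`. -/
structure TendstoInH1 {d : ℕ} (Q : Set (RSpace d × ℝ)) (v : ℕ → RSpace d × ℝ → ℝ)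
    (u ut : RSpace d × ℝ → ℝ) (Du : RSpace d × ℝ → RSpace d) : Prop where
  smooth : ∀ n, ContDiff ℝ ∞ (v n)
  tendsto : Tendsto (fun n => eLpNorm (fun z => v n z - u z) 2 (volume.restrict Q)) atTop (𝓝 0)
  tendsto_time : Tendsto
    (fun n => eLpNorm (fun z => fderiv ℝ (v n) z (0, 1) - ut z) 2 (volume.restrict Q)) atTop (𝓝 0)
  tendsto_space : Tendsto
    (fun n => eLpNorm (fun z => gradient (fun y => v n (y, z.2)) z.1 - Du z) 2
      (volume.restrict Q)) atTop (𝓝 0)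

/-- `g` is the trace on `∂Ω × (0, T)` of the function `u ∈ H¹(Ω × (0, T))` with weak derivatives
`ut` and `Du`: the trace operator is the continuous extension to `H¹` of the restriction map
`v ↦ v|_{∂Ω × (0, T)}` on functions that are smooth up to the boundary. -/
def IsLateralTrace {d : ℕ} (Ω : Set (RSpace d)) (T : ℝ) (u ut : RSpace d × ℝ → ℝ)
    (Du : RSpace d × ℝ → RSpace d) (g : RSpace d × ℝ → ℝ) : Prop :=
  MemLp g 2 (lateralMeasure Ω T) ∧
  ∃ v : ℕ → RSpace d × ℝ → ℝ, TendstoInH1 (spaceTimeCylinder Ω T) v u ut Du ∧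
    Tendsto (fun n => eLpNorm (fun z => v n z - g z) 2 (lateralMeasure Ω T)) atTop (𝓝 0)

/-- `U` is the version of `u` in `C([0, T]; L²(Ω))`; thus `U t` is the time slice `u(·, t)` for
every `t ∈ [0, T]`, end points included. Each `u ∈ H¹(Ω × (0, T))` has exactly one. -/
structure IsTimeSlices {d : ℕ} (Ω : Set (RSpace d)) (T : ℝ) (u : RSpace d × ℝ → ℝ)
    (U : ℝ → Lp ℝ 2 ((volume : Measure (RSpace d)).restrict Ω)) : Prop where
  continuousOn : ContinuousOn U (Icc 0 T)
  ae_eq : ∀ᵐ t ∂((volume : Measure ℝ).restrict (Ioo 0 T)),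
    (U t : RSpace d → ℝ) =ᵐ[(volume : Measure (RSpace d)).restrict Ω] fun x => u (x, t)

/-! ### The partition and the weight function -/

/-- `0 = t 0 < t 1 < ⋯ < t m = T`. -/
structure IsTimePartition (T : ℝ) (m : ℕ) (t : ℕ → ℝ) : Prop where
  zero : t 0 = 0
  last : t m = T
  lt_succ : ∀ j < m, t j < t (j + 1)

/-- `H₀ = min_{[0, T]} |H|`. -/
def minSpeed {d : ℕ} (T : ℝ) (H : ℝ → RSpace d) : ℝ := sInf ((fun τ => ‖H τ‖) '' Icc 0 T)

/-- The direction `v / |v|` of a vector. -/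
def direction {d : ℕ} (v : RSpace d) : RSpace d := ‖v‖⁻¹ • v

/-- `R_j = 2^j R₀ + (2^j - 1) (δ + r)`, where `R₀ = (1 + S) / (1 - S) δ` and `δ = diam Ω`. -/
def poleRadius {d : ℕ} (Ω : Set (RSpace d)) (S r : ℝ) (j : ℕ) : ℝ :=
  2 ^ j * ((1 + S) / (1 - S) * Metric.diam Ω) + (2 ^ j - 1) * (Metric.diam Ω + r)

/-- `x_j = - R_j η_j`, where `η_j` is the direction of `H (t j)`. -/
def pole {d : ℕ} (Ω : Set (RSpace d)) (S r : ℝ) (H : ℝ → RSpace d) (t : ℕ → ℝ) (j : ℕ) :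
    RSpace d :=
  -(poleRadius Ω S r j • direction (H (t j)))

/-- `β = (2 S² - 1) H₀ d(x₀)`, where `d(x₀)` is the distance from `x₀` to the closure of `Ω`. -/
def decayRate {d : ℕ} (Ω : Set (RSpace d)) (T S r : ℝ) (H : ℝ → RSpace d) (t : ℕ → ℝ) : ℝ :=
  (2 * S ^ 2 - 1) * minSpeed T H * Metric.infDist (pole Ω S r H t 0) (closure Ω)

/-- `φ_j(x, τ) = -β (τ - t_j) + |x - x_j|²`. -/
def weightPiece {d : ℕ} (Ω : Set (RSpace d)) (T S r : ℝ) (H : ℝ → RSpace d) (t : ℕ → ℝ) (j : ℕ)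
    (z : RSpace d × ℝ) : ℝ :=
  -(decayRate Ω T S r H t) * (z.2 - t j) + ‖z.1 - pole Ω S r H t j‖ ^ 2

open Classical in
/-- The weight: `φ = φ_j` for times in `[t_j, t_{j+1})`, `j < m`, extended by continuity (that is,
by `φ_{m-1}`) to the final time. -/
def weight {d : ℕ} (Ω : Set (RSpace d)) (T S r : ℝ) (H : ℝ → RSpace d) (m : ℕ) (t : ℕ → ℝ)
    (z : RSpace d × ℝ) : ℝ :=
  if z.2 < T then
    ∑ j ∈ Finset.range m, if z.2 ∈ Ico (t j) (t (j + 1)) then weightPiece Ω T S r H t j z else 0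
  else weightPiece Ω T S r H t (m - 1) z

end

/-! The argument is an energy estimate along the characteristic direction `(H, 1)`, carried out slab
by slab in time.

On the slab `[t_j, t_{j+1}]` the pole `x_j` lies far behind `Ω`, roughly opposite to `H`, so that
`Pφ_j = -β + 2 H·(x - x_j)` is bounded below by a constant `κ > 0` (`weightSlope_le`,
`weightSlope_pos`). For smooth `v`, completing a square then gives `P(v² e^{2sφ_j}) ≥ sκ v²
e^{2sφ_j} - (sκ)⁻¹ |Pv|² e^{2sφ_j}` (`le_fderiv_weightedSq`). Integrating over the slab and
multiplying by `s` leaves the two time faces and a lateral term (`slab_estimate_smooth`).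

The lateral term needs only an upper bound by the exit part of `∂Ω`, and no sharp constant. It comes
from a one-sided substitute for the divergence theorem: `∫_Ω ∂_a F` is the derivative at `0` of the
integral of `F` over the translate `Ω + h a`. For `F ≥ 0` the increment is at most the integral over
`(Ω + h a) \ Ω`, a set swept out by the exit points, and a swept volume is at most a constant times
`h |a|` times the surface measure (`exists_volume_sweep_le`, `integral_fderiv_le_exit`).

Smooth approximations converge in `L²` on `Q`, on the lateral boundary and at every time slice
(`tendsto_time_slice`), which carries the slab estimate to `H¹` (`slab_estimate`).

Finally the slabs are summed. The radii `R_j` grow so fast that `φ_{j+1} ≥ φ_j + r²` at `t_{j+1}`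
(`norm_sub_pole_add_le`). Hence for `s > 1/r²` the final-time term of one slab is at most half the
initial-time term of the next and is absorbed (`sum_slab_estimates`); only the slice at `T` survives
on the right. -/

noncomputable section

/-! ### Volume of swept sets against surface measure -/

/-- The set swept out by `B` when it is translated along `a` during times in `[0, h]`. -/
def sweep {d : ℕ} (B : Set (RSpace d)) (a : RSpace d) (h : ℝ) : Set (RSpace d) :=
  {x | ∃ p ∈ B, ∃ θ ∈ Icc 0 h, x = p + θ • a}

/-- The dimensional constant in the volume bound for swept sets. -/
def sweepConst (d : ℕ) : ENNReal :=
  2 ^ (d + 1) * volume (Metric.ball (0 : RSpace d) 1)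

theorem sweepConst_ne_top (d : ℕ) : sweepConst d ≠ ⊤ :=
  ENNReal.mul_ne_top (by finiteness) measure_ball_lt_top.ne

/-- With `L = h‖a‖`, balls of radius `2R` centred every `R` along the segment from `p₀` cover the
sweep. There are `⌊L/R⌋ + 1` of them, at most `2L/R` because `R ≤ L`, so the volume is of order
`(L/R) R^d = L R^(d-1)`. -/
theorem volume_sweep_le_of_dist_le {d : ℕ} (hd : 1 ≤ d) {B : Set (RSpace d)} {a p₀ : RSpace d}
    {h R : ℝ} (ha : a ≠ 0) (hR : 0 < R) (hRL : R ≤ h * ‖a‖) (hB : ∀ p ∈ B, dist p p₀ ≤ R) :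
    volume (sweep B a h) ≤ sweepConst d * ENNReal.ofReal (h * ‖a‖) * ENNReal.ofReal R ^ (d - 1) := by
  have hna : 0 < ‖a‖ := norm_pos_iff.2 ha
  set N := ⌊h * ‖a‖ / R⌋₊ with hN
  have hsub : sweep B a h ⊆ ⋃ k ∈ Finset.range (N + 1),
      Metric.closedBall (p₀ + (k * R / ‖a‖ : ℝ) • a) (R * 2) := by
    rintro x ⟨p, hp, θ, ⟨hθ0, hθh⟩, rfl⟩
    have h0 : 0 ≤ θ * ‖a‖ / R := by positivity
    have hk := Nat.floor_le h0
    have hk' := Nat.lt_floor_add_one (θ * ‖a‖ / R)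
    simp only [mem_iUnion, Finset.mem_range]
    refine ⟨⌊θ * ‖a‖ / R⌋₊, ?_, ?_⟩
    · have : ⌊θ * ‖a‖ / R⌋₊ ≤ N := Nat.floor_mono (by gcongr)
      omega
    set k : ℝ := (⌊θ * ‖a‖ / R⌋₊ : ℝ)
    have e : (p + θ • a) - (p₀ + (k * R / ‖a‖ : ℝ) • a) = (p - p₀) + (θ - k * R / ‖a‖) • a := by
      module
    rw [Metric.mem_closedBall, dist_eq_norm, e]
    refine (norm_add_le _ _).trans ?_
    have h1 : ‖p - p₀‖ ≤ R := by rw [← dist_eq_norm]; exact hB p hp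
    have h2 : ‖(θ - k * R / ‖a‖) • a‖ ≤ R := by
      rw [norm_smul, Real.norm_eq_abs, ← abs_of_pos hna, ← abs_mul, abs_of_pos hna, sub_mul,
        div_mul_cancel₀ _ hna.ne']
      rw [le_div_iff₀ hR] at hk
      rw [div_lt_iff₀ hR] at hk'
      rw [abs_le]; constructor <;> nlinarith
    linarith
  calc volume (sweep B a h)
      ≤ ∑ k ∈ Finset.range (N + 1),
          volume (Metric.closedBall (p₀ + (k * R / ‖a‖ : ℝ) • a) (R * 2)) :=
        (measure_mono hsub).trans (measure_biUnion_finset_le _ _)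
    _ = ENNReal.ofReal ((N + 1 : ℝ) * (R * 2) ^ d) * volume (Metric.ball (0 : RSpace d) 1) := by
        have : ∀ k : ℕ, volume (Metric.closedBall (p₀ + (k * R / ‖a‖ : ℝ) • a) (R * 2)) =
            ENNReal.ofReal ((R * 2) ^ d) * volume (Metric.ball (0 : RSpace d) 1) := fun k => by
          rw [Measure.addHaar_closedBall _ _ (by positivity)]; simp
        simp only [this, Finset.sum_const, Finset.card_range, nsmul_eq_mul]
        rw [ENNReal.ofReal_mul (by positivity), mul_assoc]
        congr 1
        rw [ENNReal.ofReal_add (by positivity) (by positivity)]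
        simp
    _ ≤ ENNReal.ofReal (2 ^ (d + 1) * (h * ‖a‖) * R ^ (d - 1)) *
          volume (Metric.ball (0 : RSpace d) 1) := by
        refine mul_le_mul_left (ENNReal.ofReal_le_ofReal ?_) _
        have h1 : (N : ℝ) ≤ h * ‖a‖ / R := Nat.floor_le (div_nonneg (hR.le.trans hRL) hR.le)
        have h2 : 1 ≤ h * ‖a‖ / R := by rwa [le_div_iff₀ hR, one_mul]
        obtain ⟨n, rfl⟩ : ∃ n, d = n + 1 := ⟨d - 1, by omega⟩
        calc (N + 1 : ℝ) * (R * 2) ^ (n + 1) ≤ (2 * (h * ‖a‖ / R)) * (R * 2) ^ (n + 1) := by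
              gcongr; linarith
          _ = _ := by
              simp only [Nat.add_sub_cancel]
              field_simp
              ring
    _ = _ := by
        have hL : 0 ≤ h * ‖a‖ := hR.le.trans hRL
        rw [ENNReal.ofReal_mul (by positivity), ENNReal.ofReal_mul (by positivity),
          ENNReal.ofReal_pow hR.le, ENNReal.ofReal_pow (by norm_num), sweepConst]
        simp only [ENNReal.ofReal_ofNat]
        ring

theorem volume_sweep_le_ediam {d : ℕ} (hd : 1 ≤ d) {B : Set (RSpace d)} {a : RSpace d}
    {h : ℝ} (ha : a ≠ 0) (hh : 0 < h) (hB : B.Nonempty)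
    (hBd : Metric.ediam B ≤ ENNReal.ofReal (h * ‖a‖)) :
    volume (sweep B a h) ≤
      sweepConst d * ENNReal.ofReal (h * ‖a‖) * Metric.ediam B ^ (d - 1) := by
  have hna : 0 < ‖a‖ := norm_pos_iff.2 ha
  have hL : 0 < h * ‖a‖ := by positivity
  obtain ⟨p₀, hp₀⟩ := hB
  have htop : Metric.ediam B ≠ ⊤ := ne_top_of_le_ne_top ENNReal.ofReal_ne_top hBd
  have hdist : ∀ p ∈ B, dist p p₀ ≤ (Metric.ediam B).toReal := fun p hp => by
    rw [dist_edist]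
    exact ENNReal.toReal_mono htop (Metric.edist_le_ediam_of_mem hp hp₀)
  rcases eq_or_ne (Metric.ediam B) 0 with h0 | h0
  -- At zero diameter every small `R` is admissible. Passing to the limit `R → 0` also gives the
  -- right value for `d = 1`, where `0 ^ 0 = 1`.
  · have hlim : Tendsto (fun R : ℝ => sweepConst d * ENNReal.ofReal (h * ‖a‖) *
        ENNReal.ofReal R ^ (d - 1)) (𝓝[>] 0)
        (𝓝 (sweepConst d * ENNReal.ofReal (h * ‖a‖) * ENNReal.ofReal 0 ^ (d - 1))) := by
      refine ENNReal.Tendsto.const_mul (ENNReal.Tendsto.pow ?_) (Or.inr ?_)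
      · exact (ENNReal.continuous_ofReal.tendsto 0).mono_left nhdsWithin_le_nhds
      · exact ENNReal.mul_ne_top (sweepConst_ne_top d) ENNReal.ofReal_ne_top
    rw [h0, ← ENNReal.ofReal_zero]
    refine ge_of_tendsto hlim ?_
    filter_upwards [Ioc_mem_nhdsGT hL] with R hR
    refine volume_sweep_le_of_dist_le hd (p₀ := p₀) ha hR.1 hR.2 fun p hp => ?_
    have := hdist p hp
    rw [h0] at this
    exact this.trans hR.1.le
  · have hpos : 0 < (Metric.ediam B).toReal := ENNReal.toReal_pos h0 htop
    have := volume_sweep_le_of_dist_le hd ha hpos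
      ((ENNReal.toReal_le_of_le_ofReal hL.le hBd)) hdist
    rwa [ENNReal.ofReal_toReal htop] at this

/-- The sweep of a union is the union of the sweeps, so the bound for one set sums over any
countable cover. Covers by sets of diameter at most `h‖a‖` suffice, since the Hausdorff measure is a
supremum over the diameter scale. -/
theorem volume_sweep_le {d : ℕ} (hd : 1 ≤ d) (B : Set (RSpace d)) {a : RSpace d}
    {h : ℝ} (ha : a ≠ 0) (hh : 0 < h) :
    volume (sweep B a h) ≤
      sweepConst d * ENNReal.ofReal (h * ‖a‖) * Measure.hausdorffMeasure ((d - 1 : ℕ) : ℝ) B := by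
  have hL : 0 < h * ‖a‖ := mul_pos hh (norm_pos_iff.2 ha)
  set c := sweepConst d * ENNReal.ofReal (h * ‖a‖) with hc
  have hctop : c ≠ ⊤ := ENNReal.mul_ne_top (sweepConst_ne_top d) ENNReal.ofReal_ne_top
  have hc0 : c ≠ 0 := by
    refine mul_ne_zero (mul_ne_zero (by positivity) ?_) (by simpa using hL)
    exact (Metric.measure_ball_pos _ _ one_pos).ne'
  rw [mul_comm, ← ENNReal.div_le_iff hc0 hctop, Measure.hausdorffMeasure_apply]
  refine le_trans ?_ (le_iSup₂ (ENNReal.ofReal (h * ‖a‖)) (by simpa using hL))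
  refine le_iInf fun t => le_iInf fun hcov => le_iInf fun htd => ?_
  rw [ENNReal.div_le_iff hc0 hctop, mul_comm, ← ENNReal.tsum_mul_left]
  have hsub : sweep B a h ⊆ ⋃ n, sweep (t n) a h := by
    rintro x ⟨p, hp, θ, hθ, rfl⟩
    obtain ⟨n, hn⟩ := mem_iUnion.1 (hcov hp)
    exact mem_iUnion.2 ⟨n, p, hn, θ, hθ, rfl⟩
  refine ((measure_mono hsub).trans (measure_iUnion_le _)).trans (ENNReal.tsum_le_tsum fun n => ?_)
  rcases (t n).eq_empty_or_nonempty with h0 | h0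
  · have : sweep (t n) a h = ∅ := by
      rw [h0]; ext x; simp [sweep]
    simp [this]
  · simp only [h0, iSup_pos, ENNReal.rpow_natCast]
    exact volume_sweep_le_ediam hd ha hh h0 (htd n)

/-- The volume swept out by a translated set is controlled by its surface measure. -/
theorem exists_volume_sweep_le (d : ℕ) (hd : 1 ≤ d) :
    ∃ K : NNReal, ∀ (B : Set (RSpace d)) (a : RSpace d) (h : ℝ), a ≠ 0 → 0 < h →
      volume (sweep B a h) ≤
        K * ENNReal.ofReal (h * ‖a‖) * Measure.euclideanHausdorffMeasure (d - 1) B := by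
  set c := Measure.addHaarScalarFactor (volume : Measure (EuclideanSpace ℝ (Fin (d - 1))))
    (Measure.hausdorffMeasure ((d - 1 : ℕ) : ℝ)) with hc
  have hc0 : c ≠ 0 := Measure.addHaarScalarFactor_volume_hausdorffMeasure_ne_zero (d - 1)
  refine ⟨(sweepConst d).toNNReal * c⁻¹, fun B a h ha hh => (volume_sweep_le hd B ha hh).trans ?_⟩
  rw [Measure.euclideanHausdorffMeasure_def, Measure.smul_apply, ← hc, ENNReal.smul_def,
    smul_eq_mul, ENNReal.coe_mul, ENNReal.coe_toNNReal (sweepConst_ne_top d)]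
  have : ((c⁻¹ : NNReal) : ENNReal) * c = 1 := by
    rw [← ENNReal.coe_mul, inv_mul_cancel₀ hc0, ENNReal.coe_one]
  set X := Measure.hausdorffMeasure ((d - 1 : ℕ) : ℝ) B
  calc _ = sweepConst d * ENNReal.ofReal (h * ‖a‖) * X * 1 := by rw [mul_one]
    _ ≤ _ := by rw [← this]; apply le_of_eq; ring

/-! ### A one-sided divergence inequality by translation -/

/-- Every segment in direction `a` that leaves `Ω` meets `G`. -/
def MeetsExits {d : ℕ} (Ω G : Set (RSpace d)) (a : RSpace d) : Prop :=
  ∀ x : RSpace d, ∀ h : ℝ, 0 < h → x ∉ Ω → x - h • a ∈ Ω → ∃ θ ∈ Icc 0 h, x - θ • a ∈ G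

/-- Layer cake: if `F x > c` at a newly covered point `x`, going back along `a` meets `G` at a point
where `F + η > c`. Each superlevel set thus lies in the sweep of a superlevel set of `F + η` in `G`,
and `hK` applies level by level. -/
theorem lintegral_translate_diff_le {d : ℕ} {K : NNReal} {Ω G : Set (RSpace d)} {a : RSpace d}
    (hK : ∀ (B : Set (RSpace d)) (a : RSpace d) (h : ℝ), a ≠ 0 → 0 < h → volume (sweep B a h) ≤
        K * ENNReal.ofReal (h * ‖a‖) * Measure.euclideanHausdorffMeasure (d - 1) B)
    (ha : a ≠ 0) (hG : MeetsExits Ω G a) {F : RSpace d → ℝ} (hF : Continuous F)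
    (hF0 : ∀ x, 0 ≤ F x) {h η : ℝ} (hh : 0 < h) (hη : 0 < η)
    (hosc : ∀ p ∈ G, ∀ θ ∈ Icc 0 h, F (p + θ • a) ≤ F p + η) :
    ∫⁻ x in {x | x ∉ Ω ∧ x - h • a ∈ Ω}, ENNReal.ofReal (F x) ≤
      K * ENNReal.ofReal (h * ‖a‖) *
        ∫⁻ p in G, ENNReal.ofReal (F p + η) ∂(Measure.euclideanHausdorffMeasure (d - 1)) := by
  rw [lintegral_eq_lintegral_meas_lt _ (Eventually.of_forall hF0) hF.aemeasurable,
    lintegral_eq_lintegral_meas_lt _ (Eventually.of_forall fun p => (add_pos_of_nonneg_of_pos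
      (hF0 p) hη).le) (by fun_prop),
    ← lintegral_const_mul' _ _ (ENNReal.mul_ne_top ENNReal.coe_ne_top ENNReal.ofReal_ne_top)]
  refine lintegral_mono fun c => ?_
  rw [Measure.restrict_apply (measurableSet_lt measurable_const hF.measurable),
    Measure.restrict_apply (measurableSet_lt measurable_const (hF.measurable.add_const η))]
  refine (measure_mono ?_).trans (hK _ a h ha hh)
  rintro x ⟨hcx, hxΩ, hxh⟩
  obtain ⟨θ, hθ, hp⟩ := hG x h hh hxΩ hxh
  refine ⟨x - θ • a, ⟨?_, hp⟩, θ, hθ, by abel⟩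
  have := hosc _ hp θ hθ
  rw [sub_add_cancel] at this
  exact lt_of_lt_of_le hcx this

theorem Continuous.integrableOn_of_isBounded {E : Type*} [NormedAddCommGroup E]
    [MeasurableSpace E] [OpensMeasurableSpace E] [ProperSpace E] {μ : Measure E}
    [IsFiniteMeasureOnCompacts μ] {F : E → ℝ} (hF : Continuous F) {A : Set E}
    (hA : Bornology.IsBounded A) : IntegrableOn F A μ :=
  (hF.continuousOn.integrableOn_compact hA.isCompact_closure).mono_set subset_closure

theorem hasDerivAt_integral_translate {d : ℕ} {Ω : Set (RSpace d)}
    (hb : Bornology.IsBounded Ω) {F : RSpace d → ℝ} (hF : ContDiff ℝ 1 F) (a : RSpace d)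
    (hΩ : MeasurableSet Ω) :
    HasDerivAt (fun h : ℝ => ∫ x in Ω, F (x + h • a)) (∫ x in Ω, fderiv ℝ F x a) 0 := by
  have hcomp : IsCompact ((fun q : RSpace d × ℝ => q.1 + q.2 • a) ''
      (closure Ω ×ˢ Metric.closedBall (0 : ℝ) 1)) :=
    (hb.isCompact_closure.prod (isCompact_closedBall _ _)).image (by fun_prop)
  have hF' : Continuous fun x => fderiv ℝ F x a :=
    (hF.continuous_fderiv (by norm_num)).clm_apply continuous_const
  obtain ⟨C, hC⟩ := (hcomp.image hF').isBounded.exists_norm_le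
  have hdiff : Differentiable ℝ F := hF.differentiable (by norm_num)
  have := hasDerivAt_integral_of_dominated_loc_of_deriv_le (μ := volume.restrict Ω)
    (F := fun (h : ℝ) x => F (x + h • a)) (x₀ := 0) (s := Metric.closedBall (0 : ℝ) 1)
    (F' := fun h x => fderiv ℝ F (x + h • a) a) (bound := fun _ => C)
    (Metric.closedBall_mem_nhds _ one_pos)
    (Eventually.of_forall fun h => (hF.continuous.comp (by fun_prop)).aestronglyMeasurable)
    ((hF.continuous.comp (by fun_prop)).integrableOn_of_isBounded hb)
    (hF'.comp (by fun_prop)).aestronglyMeasurable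
    (by
      filter_upwards [ae_restrict_mem hΩ] with x hx h hh
      exact hC _ ⟨_, ⟨(x, h), ⟨subset_closure hx, hh⟩, rfl⟩, rfl⟩)
    (by exact continuous_const.integrableOn_of_isBounded hb)
    (by
      refine Eventually.of_forall fun x h _ => ?_
      have h1 : HasDerivAt (fun h : ℝ => x + h • a) a h := by
        simpa using ((hasDerivAt_id h).smul_const a).const_add x
      exact (hdiff _).hasFDerivAt.comp_hasDerivAt h h1)
  simpa using this.2

/-- Plays the role of the divergence theorem. The part of `Ω` lost under translation contributes
with a favourable sign because `F ≥ 0`, so only exit points appear; the price is the non-sharp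
constant `K`. -/
theorem integral_fderiv_le_exit {d : ℕ} {K : NNReal} {Ω G : Set (RSpace d)} {a : RSpace d}
    (hK : ∀ (B : Set (RSpace d)) (a : RSpace d) (h : ℝ), a ≠ 0 → 0 < h → volume (sweep B a h) ≤
        K * ENNReal.ofReal (h * ‖a‖) * Measure.euclideanHausdorffMeasure (d - 1) B)
    (hΩ : IsOpen Ω) (hb : Bornology.IsBounded Ω) (hGb : Bornology.IsBounded G)
    (hGfin : Measure.euclideanHausdorffMeasure (d - 1) G ≠ ⊤)
    (hG : MeetsExits Ω G a) {F : RSpace d → ℝ} (hF : ContDiff ℝ 1 F) (hF0 : ∀ x, 0 ≤ F x) :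
    ∫ x in Ω, fderiv ℝ F x a ≤
      K * ‖a‖ * ∫ p in G, F p ∂(Measure.euclideanHausdorffMeasure (d - 1)) := by
  rcases eq_or_ne a 0 with rfl | ha
  · simp
  have hna : 0 < ‖a‖ := norm_pos_iff.2 ha
  set γ : Measure (RSpace d) := Measure.euclideanHausdorffMeasure (d - 1) with hγ
  have hc := hF.continuous
  have hfinm : IsFiniteMeasure (γ.restrict G) := ⟨by simpa using hGfin.lt_top⟩
  have hFG : IntegrableOn F G γ := by
    obtain ⟨C, hC⟩ := (hGb.isCompact_closure.image hc).isBounded.exists_norm_le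
    refine Integrable.of_bound hc.aestronglyMeasurable C ?_
    refine (ae_restrict_of_ae_restrict_of_subset (subset_closure)
      (ae_restrict_of_forall_mem isClosed_closure.measurableSet fun x hx => ?_))
    exact hC _ ⟨x, hx, rfl⟩
  -- `η` bounds the oscillation of `F` along short translates. Its total cost is proportional to
  -- `γ.real G * η`, which vanishes as `η → 0` because `G` has finite measure.
  have key : ∀ η : ℝ, 0 < η → ∫ x in Ω, fderiv ℝ F x a ≤
      K * ‖a‖ * ((∫ p in G, F p ∂γ) + γ.real G * η) := by
    intro η hη
    have hder := (hasDerivAt_integral_translate hb hF a hΩ.measurableSet).tendsto_slope_zero_right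
    refine le_of_tendsto hder ?_
    have hcomp : IsCompact ((fun q : RSpace d × ℝ => q.1 + q.2 • a) ''
      (closure G ×ˢ Metric.closedBall (0 : ℝ) 1)) :=
      (hGb.isCompact_closure.prod (isCompact_closedBall _ _)).image (by fun_prop)
    obtain ⟨δ, hδ, hδ'⟩ := Metric.uniformContinuousOn_iff.1
      (hcomp.uniformContinuousOn_of_continuous hc.continuousOn) η hη
    have hpos : 0 < min 1 (δ / ‖a‖) := lt_min one_pos (by positivity)
    filter_upwards [Ioo_mem_nhdsGT hpos] with h hh
    have hh0 : 0 < h := hh.1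
    have hh1 : h < 1 := hh.2.trans_le (min_le_left _ _)
    have hh2 : h * ‖a‖ < δ := by
      have := hh.2.trans_le (min_le_right _ _)
      rwa [lt_div_iff₀ hna] at this
    have hosc : ∀ p ∈ G, ∀ θ ∈ Icc 0 h, F (p + θ • a) ≤ F p + η := by
      intro p hp θ hθ
      have h1 := hδ' (p + θ • a) ⟨(p, θ), ⟨subset_closure hp, by
        rw [mem_closedBall_zero_iff, Real.norm_eq_abs, abs_le]
        constructor <;> linarith [hθ.1, hθ.2]⟩, rfl⟩ p ⟨(p, 0), ⟨subset_closure hp, by simp⟩,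
          by simp⟩ (by
            rw [dist_eq_norm, add_sub_cancel_left, norm_smul, Real.norm_eq_abs,
              abs_of_nonneg hθ.1]
            exact (mul_le_mul_of_nonneg_right hθ.2 hna.le).trans_lt hh2)
      rw [Real.dist_eq] at h1
      linarith [(abs_lt.1 h1).2]
    have hlin := lintegral_translate_diff_le hK ha hG hc hF0 hh0 hη hosc
    rw [← hγ] at hlin
    have hFη : Integrable (fun p => F p + η) (γ.restrict G) := hFG.add (integrable_const _)
    set E : Set (RSpace d) := {x | x ∉ Ω ∧ x - h • a ∈ Ω} with hE
    have hpre : Measurable fun x : RSpace d => x - h • a := by fun_prop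
    have hEm : MeasurableSet E := hΩ.measurableSet.compl.inter (hpre hΩ.measurableSet)
    have hbt : Bornology.IsBounded ((fun x : RSpace d => x - h • a) ⁻¹' Ω) := by
      obtain ⟨R, hR⟩ := hb.exists_norm_le
      refine isBounded_iff_forall_norm_le.2 ⟨R + ‖h • a‖, fun x hx => ?_⟩
      have := norm_add_le (x - h • a) (h • a)
      rw [sub_add_cancel] at this
      linarith [hR _ hx]
    have hbE : Bornology.IsBounded E := hbt.subset fun x hx => hx.2
    have hEr : ∫ x in E, F x ≤ K * (h * ‖a‖) * ((∫ p in G, F p ∂γ) + γ.real G * η) := by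
      have e1 : ∫ p in G, (F p + η) ∂γ = (∫ p in G, F p ∂γ) + γ.real G * η := by
        rw [integral_add hFG (integrable_const _)]
        simp [Measure.real]
      rw [← e1]
      rw [← ofReal_integral_eq_lintegral_ofReal (hc.integrableOn_of_isBounded hbE)
        (Eventually.of_forall hF0), ← ofReal_integral_eq_lintegral_ofReal
        hFη (Eventually.of_forall fun p => (add_nonneg (hF0 p) hη.le)),
        ← ENNReal.ofReal_coe_nnreal, ← ENNReal.ofReal_mul (by positivity),
        ← ENNReal.ofReal_mul (by positivity)] at hlin
      refine (ENNReal.ofReal_le_ofReal_iff ?_).1 hlin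
      have : 0 ≤ ∫ p in G, (F p + η) ∂γ := integral_nonneg fun p => (add_nonneg (hF0 p) hη.le)
      positivity
    have htr : ∫ x in Ω, F (x + h • a) = ∫ y in (fun x : RSpace d => x - h • a) ⁻¹' Ω, F y := by
      have hmp : MeasurePreserving (fun x : RSpace d => x - h • a) volume volume :=
        measurePreserving_sub_right volume (h • a)
      have := hmp.setIntegral_preimage_emb (MeasurableEquiv.subRight (h • a)).measurableEmbedding
        (fun x => F (x + h • a)) Ω
      simpa using this.symm
    -- The translate of `Ω` lies in `Ω ∪ E`; enlarging the domain is harmless for `F ≥ 0`.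
    have hle : ∫ x in Ω, F (x + h • a) ≤ (∫ x in Ω, F x) + ∫ x in E, F x := by
      rw [htr, ← setIntegral_union (disjoint_left.2 fun x hx hx' => hx'.1 hx) hEm
        (hc.integrableOn_of_isBounded hb) (hc.integrableOn_of_isBounded hbE)]
      refine setIntegral_mono_set (hc.integrableOn_of_isBounded (hb.union hbE))
        (Eventually.of_forall hF0) (LE.le.eventuallyLE fun x hx => ?_)
      by_cases hx' : x ∈ Ω
      exacts [Or.inl hx', Or.inr ⟨hx', hx⟩]
    simp only [zero_add, zero_smul, add_zero, smul_eq_mul]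
    rw [inv_mul_le_iff₀ hh0]
    calc _ ≤ _ := sub_le_iff_le_add'.2 hle
      _ ≤ _ := hEr
      _ = _ := by ring
  have hlim : Tendsto (fun η : ℝ => K * ‖a‖ * ((∫ p in G, F p ∂γ) + γ.real G * η)) (𝓝[>] 0)
      (𝓝 (K * ‖a‖ * ((∫ p in G, F p ∂γ) + γ.real G * 0))) :=
    ((by fun_prop : Continuous fun η : ℝ =>
      K * ‖a‖ * ((∫ p in G, F p ∂γ) + γ.real G * η)).tendsto 0).mono_left nhdsWithin_le_nhds
  rw [mul_zero, add_zero] at hlim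
  exact ge_of_tendsto hlim (by filter_upwards [self_mem_nhdsWithin] with η hη using key η hη)

/-! ### Outward normal and exit set -/

/-- The part of `∂Ω` through which the constant field `a` leaves `Ω` (or is tangential). -/
def exitSlice {d : ℕ} (Ω : Set (RSpace d)) (a : RSpace d) : Set (RSpace d) :=
  {p | p ∈ frontier Ω ∧ 0 ≤ inner ℝ a (outwardNormal Ω p)}

section DefiningFunction

variable {d : ℕ} {Ω : Set (RSpace d)} {p : RSpace d} {ρ ρ' : RSpace d → ℝ}

theorem eq_zero_of_eventually_mem_iff_neg (hρ : Continuous ρ)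
    (hev : ∀ᶠ x in 𝓝 p, x ∈ Ω ↔ ρ x < 0) (hΩ : IsOpen Ω) (hp : p ∈ frontier Ω) : ρ p = 0 := by
  refine le_antisymm ?_ ?_
  · refine le_of_not_gt fun hlt => ?_
    have h1 : ∀ᶠ x in 𝓝 p, 0 < ρ x := hρ.continuousAt.eventually_const_lt hlt
    obtain ⟨x, hx, hx1, hx2⟩ :=
      ((mem_closure_iff_frequently.1 hp.1).and_eventually (h1.and hev)).exists
    exact absurd (hx2.1 hx) (not_lt.2 hx1.le)
  · have : p ∉ Ω := fun h => hp.2 (by rwa [hΩ.interior_eq])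
    exact not_lt.1 fun h => this (hev.self_of_nhds.2 h)

theorem IsDefiningFunctionAt.apply_eq_zero (h : IsDefiningFunctionAt Ω p ρ) (hΩ : IsOpen Ω)
    (hp : p ∈ frontier Ω) : ρ p = 0 :=
  eq_zero_of_eventually_mem_iff_neg h.1.continuous h.2.2 hΩ hp

theorem IsDefiningFunctionAt.hasDerivAt_line (h : IsDefiningFunctionAt Ω p ρ) (v : RSpace d) :
    HasDerivAt (fun σ : ℝ => ρ (p + σ • v)) (inner ℝ (gradient ρ p) v) 0 := by
  have h1 : HasDerivAt (fun σ : ℝ => p + σ • v) v 0 := by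
    simpa using ((hasDerivAt_id (0 : ℝ)).smul_const v).const_add p
  have h2 : HasFDerivAt ρ (fderiv ℝ ρ p) (p + (0 : ℝ) • v) := by
    simpa using ((h.1.differentiable (by simp)) p).hasFDerivAt
  have := h2.comp_hasDerivAt (0 : ℝ) h1
  rwa [gradient, InnerProductSpace.toDual_symm_apply]

/-- A direction in which `ρ` decreases enters `Ω` at once, so `ρ'` is negative there too and its
one-sided slope cannot be positive. -/
theorem IsDefiningFunctionAt.inner_gradient_nonpos (h : IsDefiningFunctionAt Ω p ρ)
    (h' : IsDefiningFunctionAt Ω p ρ') (hΩ : IsOpen Ω) (hp : p ∈ frontier Ω) {v : RSpace d}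
    (hv : inner ℝ (gradient ρ p) v < 0) : inner ℝ (gradient ρ' p) v ≤ 0 := by
  have hd := (h.hasDerivAt_line v).tendsto_slope_zero_right
  have hd' := (h'.hasDerivAt_line v).tendsto_slope_zero_right
  have hline : Tendsto (fun σ : ℝ => p + σ • v) (𝓝[>] 0) (𝓝 p) := by
    have : Tendsto (fun σ : ℝ => p + σ • v) (𝓝 0) (𝓝 (p + (0 : ℝ) • v)) :=
      Continuous.tendsto (by fun_prop) 0
    rw [zero_smul, add_zero] at this
    exact this.mono_left nhdsWithin_le_nhds
  refine le_of_tendsto hd' ?_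
  filter_upwards [hd.eventually_lt_const hv, hline.eventually h.2.2, hline.eventually h'.2.2,
    self_mem_nhdsWithin] with σ h1 h2 h3 h4
  have h4 : 0 < σ := h4
  simp only [zero_add, zero_smul, add_zero, h.apply_eq_zero hΩ hp, h'.apply_eq_zero hΩ hp, sub_zero,
    smul_eq_mul] at h1 ⊢
  have h5 : ρ (p + σ • v) < 0 := by
    by_contra hc
    exact absurd h1 (not_lt.2 (mul_nonneg (inv_nonneg.2 h4.le) (not_lt.1 hc)))
  exact mul_nonpos_of_nonneg_of_nonpos (inv_nonneg.2 h4.le) (h3.1 (h2.2 h5)).le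

/-- If the unit gradients `n`, `n'` differed, the direction `n' - n` would have negative product
with `n` and positive product with `n'`, against `inner_gradient_nonpos`. -/
theorem IsDefiningFunctionAt.unit_gradient_eq (h : IsDefiningFunctionAt Ω p ρ)
    (h' : IsDefiningFunctionAt Ω p ρ') (hΩ : IsOpen Ω) (hp : p ∈ frontier Ω) :
    ‖gradient ρ p‖⁻¹ • gradient ρ p = ‖gradient ρ' p‖⁻¹ • gradient ρ' p := by
  set g := gradient ρ p with hg
  set g' := gradient ρ' p with hg'
  have hn : 0 < ‖g‖ := norm_pos_iff.2 h.2.1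
  have hn' : 0 < ‖g'‖ := norm_pos_iff.2 h'.2.1
  have hu : ‖‖g‖⁻¹ • g‖ = 1 := by rw [norm_smul, norm_inv, norm_norm, inv_mul_cancel₀ hn.ne']
  have hu' : ‖‖g'‖⁻¹ • g'‖ = 1 := by
    rw [norm_smul, norm_inv, norm_norm, inv_mul_cancel₀ hn'.ne']
  set n := ‖g‖⁻¹ • g with hnd
  set n' := ‖g'‖⁻¹ • g' with hnd'
  by_contra hne
  have hlt : inner ℝ n n' < 1 :=
    lt_of_le_of_ne (by simpa [hu, hu'] using real_inner_le_norm n n')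
      (fun h => hne ((inner_eq_one_iff_of_norm_eq_one hu hu').1 h))
  have h1 : inner ℝ g (n' - n) < 0 := by
    have e : g = ‖g‖ • n := by rw [hnd, smul_smul, mul_inv_cancel₀ hn.ne', one_smul]
    rw [e, real_inner_smul_left, inner_sub_right, real_inner_self_eq_norm_sq, hu]
    exact mul_neg_of_pos_of_neg hn (by linarith)
  have h2 := h.inner_gradient_nonpos h' hΩ hp h1
  have e : gradient ρ' p = ‖g'‖ • n' := by
    rw [hnd', smul_smul, mul_inv_cancel₀ hn'.ne', one_smul]
  rw [e, real_inner_smul_left, inner_sub_right, real_inner_self_eq_norm_sq, hu',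
    real_inner_comm] at h2
  nlinarith

theorem IsDefiningFunctionAt.outwardNormal_eq (h : IsDefiningFunctionAt Ω p ρ) (hΩ : IsOpen Ω)
    (hp : p ∈ frontier Ω) : outwardNormal Ω p = ‖gradient ρ p‖⁻¹ • gradient ρ p := by
  have hex : ∃ ρ : RSpace d → ℝ, IsDefiningFunctionAt Ω p ρ := ⟨ρ, h⟩
  rw [outwardNormal, dif_pos hex]
  exact hex.choose_spec.unit_gradient_eq h hΩ hp

theorem IsDefiningFunctionAt.continuous_gradient (h : IsDefiningFunctionAt Ω p ρ) :
    Continuous (gradient ρ) :=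
  (InnerProductSpace.toDual ℝ (RSpace d)).symm.continuous.comp (h.1.continuous_fderiv (by simp))

/-- One `ρ` serves as defining function at all nearby boundary points, so the normal is locally the
normalised gradient of a fixed smooth function. This is what makes the exit sets measurable. -/
theorem continuousOn_outwardNormal (hΩ : IsOpen Ω) (hs : HasSmoothBoundary Ω) :
    ContinuousOn (outwardNormal Ω) (frontier Ω) := by
  intro p hp
  obtain ⟨ρ, h⟩ := hs p hp
  have hg := h.continuous_gradient
  have hc : ContinuousWithinAt (fun q => ‖gradient ρ q‖⁻¹ • gradient ρ q) (frontier Ω) p :=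
    ((hg.continuousAt.norm.inv₀ (norm_ne_zero_iff.2 h.2.1)).smul
      hg.continuousAt).continuousWithinAt
  refine hc.congr_of_eventuallyEq ?_ (h.outwardNormal_eq hΩ hp)
  filter_upwards [self_mem_nhdsWithin, mem_nhdsWithin_of_mem_nhds
    (hg.continuousAt.eventually_ne h.2.1), mem_nhdsWithin_of_mem_nhds h.2.2.eventually_nhds]
    with q h1 h2 h3
  exact IsDefiningFunctionAt.outwardNormal_eq ⟨h.1, h2, h3⟩ hΩ h1

end DefiningFunction

theorem measurableSet_exitBoundary {d : ℕ} {Ω : Set (RSpace d)} (hΩ : IsOpen Ω)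
    (hs : HasSmoothBoundary Ω) {T : ℝ} {H : ℝ → RSpace d} (hH : ContinuousOn H (Icc 0 T)) :
    MeasurableSet (exitBoundary Ω T H) := by
  have hc : ContinuousOn (fun z : RSpace d × ℝ => inner ℝ (H z.2) (outwardNormal Ω z.1))
      (frontier Ω ×ˢ Ioo 0 T) :=
    ((hH.mono Ioo_subset_Icc_self).comp continuousOn_snd fun z hz => hz.2).inner
      ((continuousOn_outwardNormal hΩ hs).comp continuousOn_fst fun z hz => hz.1)
  obtain ⟨u, hu, hu'⟩ := continuousOn_iff_isClosed.1 hc (Ici 0) isClosed_Ici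
  have : exitBoundary Ω T H = u ∩ frontier Ω ×ˢ Ioo 0 T := by
    rw [← hu']
    ext z
    simp only [exitBoundary, mem_ofPred_eq, mem_inter_iff, mem_preimage, mem_Ici, mem_prod]
    tauto
  rw [this]
  exact hu.measurableSet.inter (isClosed_frontier.measurableSet.prod measurableSet_Ioo)

theorem meetsExits_exitSlice {d : ℕ} {Ω : Set (RSpace d)} (hΩ : IsOpen Ω)
    (hs : HasSmoothBoundary Ω) (a : RSpace d) : MeetsExits Ω (exitSlice Ω a) a := by
  intro x h hh hx hxh
  set y : ℝ → RSpace d := fun σ => x - h • a + σ • a with hy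
  have hyc : Continuous y := by fun_prop
  -- The segment is run forwards from the point inside `Ω`. The infimum of `Z` is the first time
  -- outside `Ω`, and the point reached then is the exit point.
  set Z := Icc 0 h ∩ y ⁻¹' Ωᶜ with hZ
  have hZc : IsCompact Z := isCompact_Icc.inter_right (hΩ.isClosed_compl.preimage hyc)
  have hZn : Z.Nonempty := ⟨h, ⟨hh.le, le_rfl⟩, by simpa [hy] using hx⟩
  obtain ⟨hτ1, hτ2⟩ := hZc.sInf_mem hZn
  set τ := sInf Z with hτ
  have hbefore : ∀ σ, 0 ≤ σ → σ < τ → y σ ∈ Ω := fun σ h0 h1 => by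
    by_contra hc
    exact absurd (csInf_le hZc.bddBelow (show σ ∈ Z from ⟨⟨h0, h1.le.trans hτ1.2⟩, hc⟩))
      (not_le.2 h1)
  have hτ0 : 0 < τ := by
    refine lt_of_le_of_ne hτ1.1 fun h0 => hτ2 ?_
    rw [← h0]
    simpa [hy] using hxh
  have hev : ∀ᶠ σ in 𝓝[<] τ, y σ ∈ Ω := by
    filter_upwards [Ico_mem_nhdsLT hτ0] with σ hσ using hbefore σ hσ.1 hσ.2
  have hp : y τ ∈ frontier Ω := by
    refine ⟨?_, by rwa [hΩ.interior_eq]⟩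
    exact mem_closure_of_tendsto (hyc.continuousAt.mono_left nhdsWithin_le_nhds) hev
  refine ⟨h - τ, ⟨by linarith [hτ1.2], by linarith⟩, ?_⟩
  have e : x - (h - τ) • a = y τ := by simp only [hy]; module
  rw [e]
  refine ⟨hp, ?_⟩
  obtain ⟨ρ, hρ⟩ := hs _ hp
  rw [hρ.outwardNormal_eq hΩ hp, real_inner_smul_right, real_inner_comm]
  refine mul_nonneg (by positivity) ?_
  -- Just before the exit time the path is in `Ω`, where `ρ < 0`. A left difference quotient is then
  -- a quotient of two negative numbers, so `∇ρ · a ≥ 0` in the limit.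
  refine ge_of_tendsto (hρ.hasDerivAt_line a).tendsto_slope_zero_left ?_
  have hline : Tendsto (fun σ : ℝ => y τ + σ • a) (𝓝[<] 0) (𝓝 (y τ)) := by
    have : Tendsto (fun σ : ℝ => y τ + σ • a) (𝓝 0) (𝓝 (y τ + (0 : ℝ) • a)) :=
      Continuous.tendsto (by fun_prop) 0
    rw [zero_smul, add_zero] at this
    exact this.mono_left nhdsWithin_le_nhds
  filter_upwards [hline.eventually hρ.2.2, Ico_mem_nhdsLT (neg_lt_zero.2 hτ0)] with σ h1 h2
  simp only [zero_add, zero_smul, add_zero, hρ.apply_eq_zero hΩ hp, sub_zero, smul_eq_mul]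
  have h3 : y τ + σ • a = y (τ + σ) := by simp only [hy]; module
  have h4 := h1.1 (h3 ▸ hbefore (τ + σ) (by linarith [h2.1]) (by linarith [h2.2]))
  exact mul_nonneg_of_nonpos_of_nonpos (inv_nonpos.2 h2.2.le) h4.le

/-! ### Finiteness of the surface measure -/

/-- Pythagoras: the component of `v` along `n` has length at most `‖v‖ / 2`, which leaves at least
`‖v‖ / 2` orthogonally. -/
theorem norm_le_two_mul_norm_orthogonalProjection {E : Type*} [NormedAddCommGroup E]
    [InnerProductSpace ℝ E] {n v : E} (h : |inner ℝ n v| ≤ ‖n‖ / 2 * ‖v‖) (hn : n ≠ 0) :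
    ‖v‖ ≤ 2 * ‖(ℝ ∙ n)ᗮ.orthogonalProjectionOnto v‖ := by
  have hnn : 0 < ‖n‖ := norm_pos_iff.2 hn
  have h1 := (ℝ ∙ n).norm_sq_eq_add_norm_sq_projection v
  have h2 : ‖(ℝ ∙ n).orthogonalProjectionOnto v‖ ≤ ‖v‖ / 2 := by
    rw [show ‖(ℝ ∙ n).orthogonalProjectionOnto v‖ = ‖(ℝ ∙ n).starProjection v‖ from rfl,
      Submodule.starProjection_singleton, norm_smul, norm_div, Real.norm_eq_abs,
      RCLike.ofReal_real_eq_id, id, Real.norm_of_nonneg (sq_nonneg ‖n‖)]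
    rw [div_mul_eq_mul_div, div_le_iff₀ (by positivity)]
    nlinarith
  have h3 : 0 ≤ ‖(ℝ ∙ n).orthogonalProjectionOnto v‖ := norm_nonneg _
  have h4 : 0 ≤ ‖(ℝ ∙ n)ᗮ.orthogonalProjectionOnto v‖ := norm_nonneg _
  have h5 : 0 ≤ ‖v‖ := norm_nonneg _
  nlinarith

/-- By compactness it is enough to work near one `p`. There `∂Ω` lies in `{ρ = 0}`, and strict
differentiability makes its chords nearly orthogonal to `∇ρ(p)`. Projection to the hyperplane
`∇ρ(p)ᗮ` is therefore injective with a 2-Lipschitz inverse, and a bounded subset of a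
`(d-1)`-dimensional space has finite measure. -/
theorem hausdorffMeasure_frontier_lt_top {d : ℕ} {Ω : Set (RSpace d)} (hΩ : IsOpen Ω)
    (hb : Bornology.IsBounded Ω) (hs : HasSmoothBoundary Ω) :
    Measure.hausdorffMeasure ((d - 1 : ℕ) : ℝ) (frontier Ω) < ⊤ := by
  have hbf : Bornology.IsBounded (frontier Ω) := hb.closure.subset frontier_subset_closure
  refine IsCompact.measure_lt_top_of_nhdsWithin
    (hb.isCompact_closure.of_isClosed_subset isClosed_frontier frontier_subset_closure)
    fun p hp => ?_
  obtain ⟨ρ, hρ⟩ := hs p hp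
  set n := gradient ρ p with hn
  have hn0 : n ≠ 0 := hρ.2.1
  have hnn : 0 < ‖n‖ := norm_pos_iff.2 hn0
  have hstrict : HasStrictFDerivAt ρ (fderiv ℝ ρ p) p :=
    hρ.1.contDiffAt.hasStrictFDerivAt (by simp)
  have hlo := hstrict.isLittleO.def (half_pos hnn)
  rw [nhds_prod_eq] at hlo
  obtain ⟨U, hU, hUU⟩ := (eventually_prod_self_iff
    (r := fun x y => ‖ρ x - ρ y - (fderiv ℝ ρ p) (x - y)‖ ≤ ‖n‖ / 2 * ‖x - y‖)).1 hlo
  -- In `V` the function `ρ` describes `Ω` near each point, not only near `p`, so it vanishes at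
  -- every boundary point in `V`.
  obtain ⟨V, hV, hVV⟩ := hρ.2.2.eventually_nhds.exists_mem
  set A := frontier Ω ∩ (U ∩ V) with hA
  have hA0 : ∀ x ∈ A, ∀ y ∈ A, ‖x - y‖ ≤
      2 * ‖(ℝ ∙ n)ᗮ.orthogonalProjectionOnto (x - y)‖ := by
    intro x hx y hy
    have h0 : ∀ x ∈ A, ρ x = 0 := fun x hx => eq_zero_of_eventually_mem_iff_neg
      hρ.1.continuous (hVV x hx.2.2) hΩ hx.1
    refine norm_le_two_mul_norm_orthogonalProjection ?_ hn0
    have h1 := hUU x hx.2.1 y hy.2.1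
    simp only [h0 x hx, h0 y hy, sub_zero, zero_sub, norm_neg] at h1
    rwa [hn, gradient, InnerProductSpace.toDual_symm_apply, ← Real.norm_eq_abs]
  refine ⟨A, inter_mem_nhdsWithin _ (inter_mem hU hV), ?_⟩
  set P := (ℝ ∙ n)ᗮ.orthogonalProjectionOnto with hP
  have hinj : InjOn P A := fun x hx y hy hxy => by
    have := hA0 x hx y hy
    rw [map_sub, hxy, sub_self, norm_zero, mul_zero] at this
    exact sub_eq_zero.1 (norm_le_zero_iff.1 this)
  set g := Function.invFunOn P A with hg
  have hgP : ∀ x ∈ A, g (P x) = x := fun x hx => hinj.leftInvOn_invFunOn hx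
  have hlip : LipschitzOnWith 2 g (P '' A) := by
    refine LipschitzOnWith.of_dist_le_mul ?_
    rintro _ ⟨x, hx, rfl⟩ _ ⟨y, hy, rfl⟩
    rw [hgP x hx, hgP y hy, dist_eq_norm, dist_eq_norm, ← map_sub]
    exact hA0 x hx y hy
  have himg : g '' (P '' A) = A := by
    rw [image_image]
    exact (image_congr hgP).trans (image_id' A)
  have hle := hlip.hausdorffMeasure_image_le (d := ((d - 1 : ℕ) : ℝ)) (by positivity)
  rw [himg] at hle
  refine hle.trans_lt (ENNReal.mul_lt_top (by finiteness) ?_)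
  have hfr : Module.finrank ℝ (ℝ ∙ n)ᗮ = d - 1 := by
    have h1 := (ℝ ∙ n).finrank_add_finrank_orthogonal
    rw [finrank_span_singleton hn0, finrank_euclideanSpace_fin] at h1
    omega
  rw [← hfr]
  have hPA : Bornology.IsBounded (P '' A) :=
    P.lipschitz.isBounded_image (hbf.subset inter_subset_left)
  exact hPA.measure_lt_top

theorem euclideanHausdorffMeasure_frontier_lt_top {d : ℕ} {Ω : Set (RSpace d)} (hΩ : IsOpen Ω)
    (hb : Bornology.IsBounded Ω) (hs : HasSmoothBoundary Ω) :
    Measure.euclideanHausdorffMeasure (d - 1) (frontier Ω) < ⊤ := by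
  rw [Measure.euclideanHausdorffMeasure_def, Measure.smul_apply, ENNReal.smul_def]
  exact ENNReal.mul_lt_top ENNReal.coe_lt_top (hausdorffMeasure_frontier_lt_top hΩ hb hs)

theorem exists_integral_fderiv_le_exitSlice {d : ℕ} (hd : 1 ≤ d) {Ω : Set (RSpace d)}
    (hΩ : IsSmoothBoundedDomain Ω) :
    ∃ K : ℝ, 0 ≤ K ∧ ∀ (a : RSpace d) (F : RSpace d → ℝ), ContDiff ℝ 1 F → (∀ x, 0 ≤ F x) →
      ∫ x in Ω, fderiv ℝ F x a ≤
        K * ‖a‖ * ∫ p in exitSlice Ω a, F p ∂(Measure.euclideanHausdorffMeasure (d - 1)) := by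
  obtain ⟨K, hK⟩ := exists_volume_sweep_le d hd
  have hsub : ∀ a, exitSlice Ω a ⊆ frontier Ω := fun a p hp => hp.1
  exact ⟨K, K.2, fun a F hF hF0 => integral_fderiv_le_exit hK hΩ.isOpen hΩ.isBounded
    ((hΩ.isBounded.closure.subset frontier_subset_closure).subset (hsub a))
    (ne_top_of_le_ne_top
      (euclideanHausdorffMeasure_frontier_lt_top hΩ.isOpen hΩ.isBounded hΩ.smooth).ne
      (measure_mono (hsub a)))
    (meetsExits_exitSlice hΩ.isOpen hΩ.smooth a) hF hF0⟩

/-! ### Geometry of the partition, the poles and the weight -/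

theorem IsTimePartition.le {T : ℝ} {m : ℕ} {t : ℕ → ℝ} (ht : IsTimePartition T m t) {i j : ℕ}
    (hij : i ≤ j) (hj : j ≤ m) : t i ≤ t j := by
  induction j, hij using Nat.le_induction with
  | base => exact le_rfl
  | succ k hk ih => exact (ih (by omega)).trans (ht.lt_succ k (by omega)).le

theorem IsTimePartition.mem_Icc {T : ℝ} {m : ℕ} {t : ℕ → ℝ} (ht : IsTimePartition T m t) {j : ℕ}
    (hj : j ≤ m) : t j ∈ Icc 0 T :=
  ⟨ht.zero ▸ ht.le (Nat.zero_le j) hj, ht.last ▸ ht.le hj le_rfl⟩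

theorem IsTimePartition.Icc_subset {T : ℝ} {m : ℕ} {t : ℕ → ℝ} (ht : IsTimePartition T m t) {j : ℕ}
    (hj : j < m) : Icc (t j) (t (j + 1)) ⊆ Icc 0 T :=
  Icc_subset_Icc (ht.mem_Icc hj.le).1 (ht.mem_Icc hj).2

theorem minSpeed_le {d : ℕ} {T : ℝ} {H : ℝ → RSpace d} {τ : ℝ} (hτ : τ ∈ Icc 0 T) :
    minSpeed T H ≤ ‖H τ‖ :=
  csInf_le ⟨0, by rintro _ ⟨σ, -, rfl⟩; exact norm_nonneg _⟩ ⟨τ, hτ, rfl⟩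

theorem one_le_dim_of_minSpeed_pos {d : ℕ} {T : ℝ} (hT : 0 < T) {H : ℝ → RSpace d}
    (hH0 : 0 < minSpeed T H) : 1 ≤ d := by
  by_contra hd
  obtain rfl : d = 0 := by omega
  have := minSpeed_le (H := H) (left_mem_Icc.2 hT.le)
  rw [Subsingleton.elim (H 0) 0, norm_zero] at this
  linarith

theorem norm_direction {d : ℕ} {v : RSpace d} (hv : v ≠ 0) : ‖direction v‖ = 1 := by
  rw [direction, norm_smul, norm_inv, norm_norm, inv_mul_cancel₀ (norm_ne_zero_iff.2 hv)]

theorem IsSmoothBoundedDomain.diam_pos {d : ℕ} (hd : 1 ≤ d) {Ω : Set (RSpace d)}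
    (hΩ : IsSmoothBoundedDomain Ω) : 0 < Metric.diam Ω := by
  have : Nonempty (Fin d) := ⟨⟨0, hd⟩⟩
  obtain ⟨x, hx⟩ := hΩ.isConnected.nonempty
  have hnt : Ω.Nontrivial := 
    (infinite_of_mem_nhds x (hΩ.isOpen.mem_nhds hx)).nontrivial
  obtain ⟨x, hx, y, hy, hxy⟩ := hnt
  exact (dist_pos.2 hxy).trans_le (Metric.dist_le_diam_of_mem hΩ.isBounded hx hy)

theorem norm_le_diam {d : ℕ} {Ω : Set (RSpace d)} (hb : Bornology.IsBounded Ω)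
    (hzero : (0 : RSpace d) ∈ closure Ω) {x : RSpace d} (hx : x ∈ closure Ω) :
    ‖x‖ ≤ Metric.diam Ω := by
  rw [← dist_zero_right, ← Metric.diam_closure]
  exact Metric.dist_le_diam_of_mem hb.closure hx hzero

/-- The closed form of `R_j` solves this recursion, and it is in this form that the radii produce
the jump of the weight. -/
theorem poleRadius_succ {d : ℕ} (Ω : Set (RSpace d)) (S r : ℝ) (j : ℕ) :
    poleRadius Ω S r (j + 1) = 2 * poleRadius Ω S r j + Metric.diam Ω + r := by
  simp only [poleRadius, pow_succ]; ring

theorem poleRadius_zero {d : ℕ} (Ω : Set (RSpace d)) (S r : ℝ) :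
    poleRadius Ω S r 0 = (1 + S) / (1 - S) * Metric.diam Ω := by
  simp [poleRadius]

theorem poleRadius_zero_le {d : ℕ} (Ω : Set (RSpace d)) {S r : ℝ} (hS0 : 0 < S) (hS1 : S < 1)
    (hr : 0 < r) (j : ℕ) : poleRadius Ω S r 0 ≤ poleRadius Ω S r j := by
  have hδ : 0 ≤ Metric.diam Ω := Metric.diam_nonneg
  have h0 : 0 ≤ poleRadius Ω S r 0 := by
    rw [poleRadius_zero]
    exact mul_nonneg (div_nonneg (by linarith) (by linarith)) hδ
  induction j with
  | zero => exact le_rfl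
  | succ j ih => rw [poleRadius_succ]; linarith

theorem diam_le_poleRadius {d : ℕ} (Ω : Set (RSpace d)) {S r : ℝ} (hS0 : 0 < S) (hS1 : S < 1)
    (hr : 0 < r) (j : ℕ) : Metric.diam Ω ≤ poleRadius Ω S r j := by
  refine le_trans ?_ (poleRadius_zero_le Ω hS0 hS1 hr j)
  rw [poleRadius_zero]
  refine le_mul_of_one_le_left Metric.diam_nonneg ?_
  rw [le_div_iff₀ (by linarith)]
  linarith

theorem norm_pole {d : ℕ} {Ω : Set (RSpace d)} {S r : ℝ} {H : ℝ → RSpace d} {t : ℕ → ℝ} {j : ℕ}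
    (hR : 0 ≤ poleRadius Ω S r j) (hH : H (t j) ≠ 0) :
    ‖pole Ω S r H t j‖ = poleRadius Ω S r j := by
  rw [pole, norm_neg, norm_smul, norm_direction hH, mul_one, Real.norm_of_nonneg hR]

/-- The lower bound for `Pφ_j`. -/
def weightSlope (δ S H₀ : ℝ) : ℝ :=
  2 * (H₀ * ((1 + S) / (1 - S) * δ * S - δ)) - (2 * S ^ 2 - 1) * H₀ * ((1 + S) / (1 - S) * δ)

/-- Up to the positive factor `H₀ δ / (1 - S)` the slope is `5S - 2S³ - 1 = (3S - 1) + 2S(1 - S²)`,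
positive once `1/2 < S < 1`. -/
theorem weightSlope_pos {δ S H₀ : ℝ} (hδ : 0 < δ) (hH : 0 < H₀) (hS0 : 1 / 2 < S ^ 2)
    (hS : 0 < S) (hS1 : S < 1) : 0 < weightSlope δ S H₀ := by
  have h1 : 0 < 1 - S := by linarith
  have e : weightSlope δ S H₀ = H₀ * δ / (1 - S) * (5 * S - 2 * S ^ 3 - 1) := by
    rw [weightSlope]; field_simp; ring
  rw [e]
  refine mul_pos (by positivity) ?_
  have h2 : 1 / 2 < S := by nlinarith
  nlinarith [mul_pos hS h1, mul_pos (mul_pos hS h1) (by linarith : 0 < 1 + S)]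

theorem half_lt_sq_of_mem_Ioo {S : ℝ} (hS : S ∈ Ioo (1 / Real.sqrt 2) 1) :
    0 < S ∧ 1 / 2 < S ^ 2 := by
  have h1 : 0 < 1 / Real.sqrt 2 := by positivity
  have h2 : 0 < S := h1.trans hS.1
  refine ⟨h2, ?_⟩
  have h3 := pow_lt_pow_left₀ hS.1 h1.le (two_ne_zero)
  rwa [div_pow, one_pow, Real.sq_sqrt (by norm_num)] at h3

section Weight

variable {d : ℕ} {Ω : Set (RSpace d)} {T S r : ℝ} {H : ℝ → RSpace d} {m : ℕ} {t : ℕ → ℝ}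

theorem ne_zero_of_minSpeed_pos (hH0 : 0 < minSpeed T H) {τ : ℝ} (hτ : τ ∈ Icc 0 T) : H τ ≠ 0 :=
  norm_pos_iff.1 (hH0.trans_le (minSpeed_le hτ))

theorem decayRate_nonneg (hH0 : 0 < minSpeed T H) (hS : S ∈ Ioo (1 / Real.sqrt 2) 1) :
    0 ≤ decayRate Ω T S r H t := by
  have := (half_lt_sq_of_mem_Ioo hS).2
  exact mul_nonneg (mul_nonneg (by linarith) hH0.le) Metric.infDist_nonneg

/-- As `0 ∈ closure Ω`, the distance from `x₀` to `Ω` is at most `R₀`, which bounds `β`. In `H·(x -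
x_j) = H·x + R_j H·η_j` the first term is at least `-|H| δ`, and the cone condition makes the second
at least `R₀ S |H|`. -/
theorem weightSlope_le (hΩ : IsSmoothBoundedDomain Ω) (hzero : (0 : RSpace d) ∈ closure Ω)
    (hH0 : 0 < minSpeed T H) (hS : S ∈ Ioo (1 / Real.sqrt 2) 1) (hr : 0 < r)
    (ht : IsTimePartition T m t) (hd : 1 ≤ d)
    (hcone : ∀ j < m, ∀ τ ∈ Icc (t j) (t (j + 1)),
      S ≤ inner ℝ (direction (H τ)) (direction (H (t j)))) {j : ℕ} (hj : j < m) {τ : ℝ}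
    (hτ : τ ∈ Icc (t j) (t (j + 1))) {x : RSpace d} (hx : x ∈ closure Ω) :
    weightSlope (Metric.diam Ω) S (minSpeed T H) ≤
      -decayRate Ω T S r H t + 2 * inner ℝ (H τ) (x - pole Ω S r H t j) := by
  obtain ⟨hS0, hS2⟩ := half_lt_sq_of_mem_Ioo hS
  have hS1 := hS.2
  have hδ := hΩ.diam_pos hd
  have hτT := ht.Icc_subset hj hτ
  have h0 := ne_zero_of_minSpeed_pos hH0 hτT
  have hn := norm_pos_iff.2 h0
  set δ := Metric.diam Ω with hδd
  set R₀ := (1 + S) / (1 - S) * δ with hR₀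
  have hR0 : poleRadius Ω S r 0 = R₀ := poleRadius_zero Ω S r
  have hR0nn : 0 ≤ poleRadius Ω S r 0 :=
    hδ.le.trans (diam_le_poleRadius Ω hS0 hS1 hr 0)
  have hRj := poleRadius_zero_le Ω hS0 hS1 hr j
  have hβ : decayRate Ω T S r H t ≤ (2 * S ^ 2 - 1) * minSpeed T H * R₀ := by
    refine mul_le_mul_of_nonneg_left ?_ (mul_nonneg (by linarith) hH0.le)
    refine (Metric.infDist_le_dist_of_mem hzero).trans ?_
    rw [dist_zero_right, norm_pole hR0nn
      (ne_zero_of_minSpeed_pos hH0 (ht.mem_Icc (Nat.zero_le m))), hR0]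
  have hη : S * ‖H τ‖ ≤ inner ℝ (H τ) (direction (H (t j))) := by
    have := hcone j hj τ hτ
    rw [direction, real_inner_smul_left, inv_mul_eq_div, le_div_iff₀ hn] at this
    exact this
  have hxin : -(‖H τ‖ * δ) ≤ inner ℝ (H τ) x := by
    have h1 := abs_real_inner_le_norm (H τ) x
    have h2 : ‖H τ‖ * ‖x‖ ≤ ‖H τ‖ * δ :=
      mul_le_mul_of_nonneg_left (norm_le_diam hΩ.isBounded hzero hx) hn.le
    linarith [neg_abs_le (inner ℝ (H τ) x)]
  -- The sign is needed to replace `|H(τ)|` by its minimum in the lower bound.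
  have hRS : 0 ≤ R₀ * S - δ := by
    have h1 : 1 ≤ (1 + S) / (1 - S) * S := by
      rw [div_mul_eq_mul_div, le_div_iff₀ (by linarith)]; nlinarith
    have h2 : R₀ * S = ((1 + S) / (1 - S) * S) * δ := by rw [hR₀]; ring
    nlinarith
  have hmain : minSpeed T H * (R₀ * S - δ) ≤ inner ℝ (H τ) (x - pole Ω S r H t j) := by
    rw [pole, sub_neg_eq_add, inner_add_right, real_inner_smul_right]
    have h1 : minSpeed T H * (R₀ * S - δ) ≤ ‖H τ‖ * (R₀ * S - δ) :=
      mul_le_mul_of_nonneg_right (minSpeed_le hτT) hRS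
    have h2 : R₀ * (S * ‖H τ‖) ≤ poleRadius Ω S r j * inner ℝ (H τ) (direction (H (t j))) :=
      mul_le_mul (hR0 ▸ hRj) hη (by positivity) (hR0nn.trans hRj)
    nlinarith
  rw [weightSlope]
  linarith

/-- Only the radii matter, not the directions: `|x - x_j| ≤ R_j + δ`, while `|x - x_{j+1}| ≥ R_{j+1}
- δ = 2R_j + r`, and `R_j ≥ δ`. -/
theorem norm_sub_pole_add_le (hΩ : IsSmoothBoundedDomain Ω) (hzero : (0 : RSpace d) ∈ closure Ω)
    (hH0 : 0 < minSpeed T H) (hS : S ∈ Ioo (1 / Real.sqrt 2) 1) (hr : 0 < r)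
    (ht : IsTimePartition T m t) {j : ℕ} (hj : j + 1 ≤ m) {x : RSpace d} (hx : x ∈ closure Ω) :
    ‖x - pole Ω S r H t j‖ + r ≤ ‖x - pole Ω S r H t (j + 1)‖ := by
  obtain ⟨hS0, -⟩ := half_lt_sq_of_mem_Ioo hS
  have hx' := norm_le_diam hΩ.isBounded hzero hx
  have hRδ := fun j => diam_le_poleRadius Ω hS0 hS.2 hr j
  have hp : ∀ k ≤ m, ‖pole Ω S r H t k‖ = poleRadius Ω S r k := fun k hk =>
    norm_pole (Metric.diam_nonneg.trans (hRδ k)) (ne_zero_of_minSpeed_pos hH0 (ht.mem_Icc hk))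
  have h1 := norm_sub_le x (pole Ω S r H t j)
  have h2 := norm_sub_norm_le (pole Ω S r H t (j + 1)) x
  rw [norm_sub_rev] at h2
  rw [hp j (by omega)] at h1
  rw [hp (j + 1) hj, poleRadius_succ] at h2
  linarith [hRδ j]

end Weight

/-! ### The pointwise Carleman inequality -/

theorem fderiv_slice {d : ℕ} {v : RSpace d × ℝ → ℝ} (hv : Differentiable ℝ v) (z : RSpace d × ℝ)
    (a : RSpace d) : fderiv ℝ (fun y => v (y, z.2)) z.1 a = fderiv ℝ v z (a, 0) := by
  have h1 : HasFDerivAt (fun y : RSpace d => (y, z.2))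
      ((ContinuousLinearMap.id ℝ (RSpace d)).prod 0) z.1 :=
    (hasFDerivAt_id z.1).prodMk (hasFDerivAt_const z.2 z.1)
  have h2 : HasFDerivAt (fun y => v (y, z.2))
      ((fderiv ℝ v z).comp ((ContinuousLinearMap.id ℝ (RSpace d)).prod 0)) z.1 :=
    HasFDerivAt.comp z.1 (hv z).hasFDerivAt h1
  rw [h2.fderiv]; simp

theorem hasDerivAt_time_slice {d : ℕ} {v : RSpace d × ℝ → ℝ} (hv : Differentiable ℝ v)
    (x : RSpace d) (τ : ℝ) :
    HasDerivAt (fun σ => v (x, σ)) (fderiv ℝ v (x, τ) (0, 1)) τ := by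
  have h1 : HasDerivAt (fun σ : ℝ => (x, σ)) ((0 : RSpace d), (1 : ℝ)) τ :=
    (hasDerivAt_const τ x).prodMk (hasDerivAt_id τ)
  exact (hv (x, τ)).hasFDerivAt.comp_hasDerivAt τ h1

/-- For smooth functions `P` is differentiation in the space-time direction `(H, 1)`; the energy
argument uses it in this form. -/
theorem transportOp_smooth {d : ℕ} {v : RSpace d × ℝ → ℝ} (hv : Differentiable ℝ v)
    (H : ℝ → RSpace d) (z : RSpace d × ℝ) :
    transportOp H (fun z => fderiv ℝ v z (0, 1))
      (fun z => gradient (fun y => v (y, z.2)) z.1) z = fderiv ℝ v z (H z.2, 1) := by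
  have e : ((H z.2, 1) : RSpace d × ℝ) = (0, 1) + (H z.2, 0) := by simp
  rw [transportOp, real_inner_comm, gradient, InnerProductSpace.toDual_symm_apply,
    fderiv_slice hv, e, map_add]

/-- The weight `-β (τ - a) + |x - x₀|²`. -/
def slabWeight {d : ℕ} (β a : ℝ) (x₀ : RSpace d) (z : RSpace d × ℝ) : ℝ :=
  -β * (z.2 - a) + ‖z.1 - x₀‖ ^ 2

/-- The density `v² e^{2 s φ}`. -/
def weightedSq {d : ℕ} (β a : ℝ) (x₀ : RSpace d) (s : ℝ) (v : RSpace d × ℝ → ℝ)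
    (z : RSpace d × ℝ) : ℝ :=
  v z ^ 2 * Real.exp (2 * s * slabWeight β a x₀ z)

section Slab

variable {d : ℕ} (β a : ℝ) (x₀ : RSpace d) (s : ℝ) {v : RSpace d × ℝ → ℝ}

theorem contDiff_slabWeight {n : WithTop ℕ∞} : ContDiff ℝ n (slabWeight β a x₀) := by
  unfold slabWeight
  exact (contDiff_const.mul (contDiff_snd.sub contDiff_const)).add
    ((contDiff_fst.sub contDiff_const).norm_sq ℝ)

theorem contDiff_weightedSq {n : WithTop ℕ∞} (hv : ContDiff ℝ n v) :
    ContDiff ℝ n (weightedSq β a x₀ s v) :=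
  (hv.pow 2).mul (Real.contDiff_exp.comp (contDiff_const.mul (contDiff_slabWeight β a x₀)))

theorem weightedSq_nonneg (z : RSpace d × ℝ) : 0 ≤ weightedSq β a x₀ s v z := by
  unfold weightedSq; positivity

theorem fderiv_slabWeight (z : RSpace d × ℝ) (η : RSpace d) :
    fderiv ℝ (slabWeight β a x₀) z (η, 1) = -β + 2 * inner ℝ η (z.1 - x₀) := by
  have h1 : HasFDerivAt (fun z : RSpace d × ℝ => z.1 - x₀)
      (ContinuousLinearMap.fst ℝ (RSpace d) ℝ) z := hasFDerivAt_fst.sub_const x₀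
  have h2 : HasFDerivAt (fun z : RSpace d × ℝ => -β * (z.2 - a))
      ((-β) • ContinuousLinearMap.snd ℝ (RSpace d) ℝ) z :=
    (hasFDerivAt_snd.sub_const a).const_mul (-β)
  have h3 := h2.add h1.norm_sq
  have h4 : fderiv ℝ (slabWeight β a x₀) z = _ := h3.fderiv
  rw [h4]
  simp [real_inner_comm]
  rw [inner_sub_right, real_inner_comm x₀ η]

theorem fderiv_weightedSq (hv : ContDiff ℝ ∞ v) (z ζ : RSpace d × ℝ) :
    fderiv ℝ (weightedSq β a x₀ s v) z ζ =
      2 * v z * fderiv ℝ v z ζ * Real.exp (2 * s * slabWeight β a x₀ z) +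
        2 * s * fderiv ℝ (slabWeight β a x₀) z ζ * weightedSq β a x₀ s v z := by
  have h1 := (hv.differentiable (by simp) z).hasFDerivAt
  have h2 := ((contDiff_slabWeight (n := 1) β a x₀).differentiable (by simp) z).hasFDerivAt
  have h3 := (h1.pow 2).mul (h2.const_mul (2 * s)).exp
  have h4 : fderiv ℝ (weightedSq β a x₀ s v) z = _ := h3.fderiv
  rw [h4]
  simp [weightedSq]
  ring

/-- The pointwise Carleman inequality. -/
theorem le_fderiv_weightedSq (hv : ContDiff ℝ ∞ v) (hs : 0 < s) {κ : ℝ} (hκ : 0 < κ)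
    {z : RSpace d × ℝ} {η : RSpace d} (h : κ ≤ -β + 2 * inner ℝ η (z.1 - x₀)) :
    s * κ * weightedSq β a x₀ s v z -
        (s * κ)⁻¹ * (fderiv ℝ v z (η, 1) ^ 2 * Real.exp (2 * s * slabWeight β a x₀ z)) ≤
      fderiv ℝ (weightedSq β a x₀ s v) z (η, 1) := by
  rw [fderiv_weightedSq β a x₀ s hv, fderiv_slabWeight]
  set p := fderiv ℝ v z (η, 1)
  set w := Real.exp (2 * s * slabWeight β a x₀ z) with hw
  have hw0 : 0 < w := Real.exp_pos _
  have hF : weightedSq β a x₀ s v z = v z ^ 2 * w := rfl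
  rw [hF]
  have hsκ : 0 < s * κ := mul_pos hs hκ
  have h1 : 2 * s * κ * (v z ^ 2 * w) ≤
      2 * s * (-β + 2 * inner ℝ η (z.1 - x₀)) * (v z ^ 2 * w) := by gcongr
  -- The weight gives `2sκ v²`. Half of it completes the square with the cross term `2 v p`, and the
  -- other half is the gain.
  have h2 : 0 ≤ (s * κ)⁻¹ * (p + s * κ * v z) ^ 2 * w := by positivity
  have h3 : (s * κ)⁻¹ * (p + s * κ * v z) ^ 2 * w =
      (s * κ)⁻¹ * (p ^ 2 * w) + 2 * v z * p * w + s * κ * (v z ^ 2 * w) := by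
    field_simp; ring
  linarith

end Slab

/-! ### Integration over a slab and the smooth energy inequality -/

theorem integrableOn_slab {d : ℕ} {Ω : Set (RSpace d)} (hb : Bornology.IsBounded Ω) {a b : ℝ}
    {f : RSpace d × ℝ → ℝ} (hf : ContinuousOn f (closure Ω ×ˢ Icc a b)) :
    IntegrableOn f (Ω ×ˢ Ioo a b) :=
  (hf.integrableOn_compact (hb.isCompact_closure.prod isCompact_Icc)).mono_set
    (prod_mono subset_closure Ioo_subset_Icc_self)

theorem setIntegral_slab {d : ℕ} {Ω : Set (RSpace d)} {I : Set ℝ} {f : RSpace d × ℝ → ℝ}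
    (hf : IntegrableOn f (Ω ×ˢ I)) :
    ∫ z in Ω ×ˢ I, f z = ∫ x in Ω, ∫ τ in I, f (x, τ) := by
  rw [Measure.volume_eq_prod] at hf ⊢
  exact setIntegral_prod f hf

theorem setIntegral_slab_symm {d : ℕ} {Ω : Set (RSpace d)} {I : Set ℝ} {f : RSpace d × ℝ → ℝ}
    (hf : IntegrableOn f (Ω ×ˢ I)) :
    ∫ z in Ω ×ˢ I, f z = ∫ τ in I, ∫ x in Ω, f (x, τ) := by
  rw [IntegrableOn, Measure.volume_eq_prod, ← Measure.prod_restrict] at hf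
  rw [Measure.volume_eq_prod, ← Measure.prod_restrict]
  exact integral_prod_symm f hf

theorem integral_time_deriv_slab {d : ℕ} {Ω : Set (RSpace d)} (hb : Bornology.IsBounded Ω)
    {a b : ℝ} (hab : a ≤ b) {F : RSpace d × ℝ → ℝ} (hF : ContDiff ℝ 1 F) :
    ∫ z in Ω ×ˢ Ioo a b, fderiv ℝ F z (0, 1) = (∫ x in Ω, F (x, b)) - ∫ x in Ω, F (x, a) := by
  have hc : Continuous fun z => fderiv ℝ F z (0, 1) :=
    (hF.continuous_fderiv (by simp)).clm_apply continuous_const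
  have hi : ∀ c : ℝ, IntegrableOn (fun x => F (x, c)) Ω := fun c =>
    (hF.continuous.comp (by fun_prop : Continuous fun x : RSpace d => (x, c)))
      |>.integrableOn_of_isBounded hb
  rw [setIntegral_slab (integrableOn_slab hb hc.continuousOn), ← integral_sub (hi b) (hi a)]
  refine integral_congr_ae (Eventually.of_forall fun x => ?_)
  simp only
  rw [← integral_Ioc_eq_integral_Ioo, ← intervalIntegral.integral_of_le hab]
  exact intervalIntegral.integral_eq_sub_of_hasDerivAt (fun τ _ =>
    hasDerivAt_time_slice (hF.differentiable (by simp)) x τ)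
    ((hc.comp (by fun_prop)).intervalIntegrable _ _)

theorem measurableSet_exitSlice {d : ℕ} {Ω : Set (RSpace d)} (hΩ : IsOpen Ω)
    (hs : HasSmoothBoundary Ω) (a : RSpace d) : MeasurableSet (exitSlice Ω a) := by
  have hc : ContinuousOn (fun p : RSpace d => inner ℝ a (outwardNormal Ω p)) (frontier Ω) :=
    continuousOn_const.inner (continuousOn_outwardNormal hΩ hs)
  obtain ⟨u, hu, hu'⟩ := continuousOn_iff_isClosed.1 hc (Ici 0) isClosed_Ici
  have : exitSlice Ω a = u ∩ frontier Ω := by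
    rw [← hu']
    ext z
    simp only [exitSlice, mem_ofPred_eq, mem_inter_iff, mem_preimage, mem_Ici]
    tauto
  rw [this]
  exact hu.measurableSet.inter isClosed_frontier.measurableSet

theorem isFiniteMeasure_lateralMeasure {d : ℕ} {Ω : Set (RSpace d)}
    (hΩ : IsSmoothBoundedDomain Ω) (T : ℝ) : IsFiniteMeasure (lateralMeasure Ω T) := by
  have : IsFiniteMeasure ((Measure.euclideanHausdorffMeasure (d - 1) :
      Measure (RSpace d)).restrict (frontier Ω)) :=
    ⟨by simpa using
      euclideanHausdorffMeasure_frontier_lt_top hΩ.isOpen hΩ.isBounded hΩ.smooth⟩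
  unfold lateralMeasure
  infer_instance

theorem ae_lateralMeasure_mem {d : ℕ} {Ω : Set (RSpace d)} (hΩ : IsSmoothBoundedDomain Ω) (T : ℝ) :
    ∀ᵐ z ∂(lateralMeasure Ω T), z ∈ closure Ω ×ˢ Icc 0 T := by
  have : IsFiniteMeasure ((Measure.euclideanHausdorffMeasure (d - 1) :
      Measure (RSpace d)).restrict (frontier Ω)) :=
    ⟨by simpa using
      euclideanHausdorffMeasure_frontier_lt_top hΩ.isOpen hΩ.isBounded hΩ.smooth⟩
  have h1 : ∀ᵐ x ∂((Measure.euclideanHausdorffMeasure (d - 1) :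
      Measure (RSpace d)).restrict (frontier Ω)), x ∈ closure Ω :=
    ae_restrict_of_forall_mem isClosed_frontier.measurableSet
      fun x hx => frontier_subset_closure hx
  have h2 : ∀ᵐ τ ∂((volume : Measure ℝ).restrict (Ioo 0 T)), τ ∈ Icc 0 T :=
    ae_restrict_of_forall_mem measurableSet_Ioo fun x hx => Ioo_subset_Icc_self hx
  exact (Measure.ae_prod_mem_iff_ae_ae_mem
    (isClosed_closure.measurableSet.prod measurableSet_Icc)).2
    (by filter_upwards [h1] with x hx; filter_upwards [h2] with τ hτ; exact ⟨hx, hτ⟩)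

theorem Continuous.integrable_lateralMeasure {d : ℕ} {Ω : Set (RSpace d)}
    (hΩ : IsSmoothBoundedDomain Ω) (T : ℝ) {F : RSpace d × ℝ → ℝ} (hF : Continuous F) :
    Integrable F (lateralMeasure Ω T) := by
  have := isFiniteMeasure_lateralMeasure hΩ T
  obtain ⟨C, hC⟩ := ((hΩ.isBounded.isCompact_closure.prod
    (isCompact_Icc (a := 0) (b := T))).image hF).isBounded.exists_norm_le
  refine Integrable.of_bound hF.aestronglyMeasurable C ?_
  filter_upwards [ae_lateralMeasure_mem hΩ T] with z hz using hC _ ⟨z, hz, rfl⟩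

/-- The part of the exit boundary with times in `(a, b)`. -/
def exitSlab {d : ℕ} (Ω : Set (RSpace d)) (T : ℝ) (H : ℝ → RSpace d) (a b : ℝ) :
    Set (RSpace d × ℝ) :=
  exitBoundary Ω T H ∩ Prod.snd ⁻¹' Ioo a b

/-- Fubini: the section of the exit boundary at time `τ` is the exit set of the constant field `H
τ`, to which the translation inequality applies. -/
theorem integral_exitSlab {d : ℕ} {Ω : Set (RSpace d)} (hΩ : IsSmoothBoundedDomain Ω) {T : ℝ}
    {H : ℝ → RSpace d} (hH : ContinuousOn H (Icc 0 T)) {a b : ℝ} (ha : 0 ≤ a) (hb : b ≤ T)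
    {F : RSpace d × ℝ → ℝ} (hF : Continuous F) :
    IntegrableOn (fun τ => ∫ p in exitSlice Ω (H τ), F (p, τ)
      ∂(Measure.euclideanHausdorffMeasure (d - 1))) (Ioo a b) ∧
    ∫ z in exitSlab Ω T H a b, F z ∂(lateralMeasure Ω T) =
      ∫ τ in Ioo a b, ∫ p in exitSlice Ω (H τ), F (p, τ)
        ∂(Measure.euclideanHausdorffMeasure (d - 1)) := by
  set γ : Measure (RSpace d) := Measure.euclideanHausdorffMeasure (d - 1) with hγ
  have hfin : IsFiniteMeasure (γ.restrict (frontier Ω)) :=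
    ⟨by simpa using
      euclideanHausdorffMeasure_frontier_lt_top hΩ.isOpen hΩ.isBounded hΩ.smooth⟩
  have hm : MeasurableSet (exitSlab Ω T H a b) :=
    (measurableSet_exitBoundary hΩ.isOpen hΩ.smooth hH).inter (measurable_snd measurableSet_Ioo)
  have hint : Integrable ((exitSlab Ω T H a b).indicator F) (lateralMeasure Ω T) :=
    (hF.integrable_lateralMeasure hΩ T).indicator hm
  have hsec : ∀ τ ∈ Ioo 0 T, ∫ p in frontier Ω, (exitSlab Ω T H a b).indicator F (p, τ) ∂γ =
      (Ioo a b).indicator (fun τ => ∫ p in exitSlice Ω (H τ), F (p, τ) ∂γ) τ := by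
    intro τ hτ
    by_cases hab : τ ∈ Ioo a b
    · rw [indicator_of_mem hab]
      have hsub : exitSlice Ω (H τ) ∩ frontier Ω = exitSlice Ω (H τ) :=
        inter_eq_left.2 fun p hp => hp.1
      rw [← hsub, ← Measure.restrict_restrict
        (measurableSet_exitSlice hΩ.isOpen hΩ.smooth (H τ)), ← integral_indicator
        (measurableSet_exitSlice hΩ.isOpen hΩ.smooth (H τ))]
      refine integral_congr_ae (Eventually.of_forall fun p => ?_)
      by_cases hp : p ∈ exitSlice Ω (H τ)
      · rw [indicator_of_mem hp]
        exact indicator_of_mem (show (p, τ) ∈ exitSlab Ω T H a b from ⟨⟨hp.1, hτ, hp.2⟩, hab⟩) F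
      · rw [indicator_of_notMem hp]
        exact indicator_of_notMem
          (fun h : (p, τ) ∈ exitSlab Ω T H a b => hp ⟨h.1.1, h.1.2.2⟩) F
    · rw [indicator_of_notMem hab]
      refine integral_eq_zero_of_ae (Eventually.of_forall fun p => ?_)
      exact indicator_of_notMem (fun h : (p, τ) ∈ exitSlab Ω T H a b => hab h.2) F
  have hsub : Ioo a b ∩ Ioo 0 T = Ioo a b := inter_eq_left.2 (Ioo_subset_Ioo ha hb)
  have haeq : (fun τ => ∫ p in frontier Ω, (exitSlab Ω T H a b).indicator F (p, τ) ∂γ)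
      =ᵐ[volume.restrict (Ioo 0 T)]
      (Ioo a b).indicator (fun τ => ∫ p in exitSlice Ω (H τ), F (p, τ) ∂γ) :=
    ae_restrict_of_forall_mem measurableSet_Ioo hsec
  rw [lateralMeasure] at hint
  constructor
  · have h1 := hint.integral_prod_right.congr haeq
    rw [integrable_indicator_iff measurableSet_Ioo, IntegrableOn,
      Measure.restrict_restrict measurableSet_Ioo, hsub] at h1
    exact h1
  · rw [← integral_indicator hm, lateralMeasure, integral_prod_symm _ hint,
      integral_congr_ae haeq, integral_indicator measurableSet_Ioo,
      Measure.restrict_restrict measurableSet_Ioo, hsub]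

/-- The energy inequality on a slab, for functions smooth up to the boundary. -/
theorem slab_estimate_smooth {d : ℕ} {Ω : Set (RSpace d)} (hΩ : IsSmoothBoundedDomain Ω) {T : ℝ}
    {H : ℝ → RSpace d} (hH : ContinuousOn H (Icc 0 T)) {K M : ℝ} (hK0 : 0 ≤ K)
    (hK : ∀ (a : RSpace d) (F : RSpace d → ℝ), ContDiff ℝ 1 F → (∀ x, 0 ≤ F x) →
      ∫ x in Ω, fderiv ℝ F x a ≤
        K * ‖a‖ * ∫ p in exitSlice Ω a, F p ∂(Measure.euclideanHausdorffMeasure (d - 1)))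
    (hM : ∀ τ ∈ Icc 0 T, ‖H τ‖ ≤ M) {a b : ℝ} (ha : 0 ≤ a) (hab : a ≤ b) (hb : b ≤ T)
    {β : ℝ} {x₀ : RSpace d} {κ : ℝ} (hκ : 0 < κ)
    (hslope : ∀ τ ∈ Icc a b, ∀ x ∈ closure Ω, κ ≤ -β + 2 * inner ℝ (H τ) (x - x₀))
    {v : RSpace d × ℝ → ℝ} (hv : ContDiff ℝ ∞ v) {s : ℝ} (hs : 0 < s) :
    s ^ 2 * κ * (∫ z in Ω ×ˢ Ioo a b, weightedSq β a x₀ s v z)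
        + s * ∫ x in Ω, weightedSq β a x₀ s v (x, a) ≤
      κ⁻¹ * (∫ z in Ω ×ˢ Ioo a b, fderiv ℝ v z (H z.2, 1) ^ 2 *
          Real.exp (2 * s * slabWeight β a x₀ z))
        + s * (∫ x in Ω, weightedSq β a x₀ s v (x, b))
        + s * (K * M * ∫ z in exitSlab Ω T H a b, weightedSq β a x₀ s v z
            ∂(lateralMeasure Ω T)) := by
  set F := weightedSq β a x₀ s v with hFdef
  have hbd := hΩ.isBounded
  have hF : ContDiff ℝ 1 F := contDiff_weightedSq β a x₀ s (hv.of_le (by simp))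
  have hF0 : ∀ z, 0 ≤ F z := weightedSq_nonneg β a x₀ s
  have hHab : ContinuousOn H (Icc a b) := hH.mono (Icc_subset_Icc ha hb)
  have hH2 : ContinuousOn (fun z : RSpace d × ℝ => H z.2) (closure Ω ×ˢ Icc a b) :=
    hHab.comp continuousOn_snd fun z hz => hz.2
  have hdF := hF.continuous_fderiv (by simp)
  have hdv := hv.continuous_fderiv (by simp)
  have hwc : Continuous fun z => Real.exp (2 * s * slabWeight β a x₀ z) :=
    Real.continuous_exp.comp (continuous_const.mul
      (contDiff_slabWeight (n := 1) β a x₀).continuous)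
  have iF : IntegrableOn F (Ω ×ˢ Ioo a b) := integrableOn_slab hbd hF.continuous.continuousOn
  have iG : IntegrableOn (fun z => fderiv ℝ v z (H z.2, 1) ^ 2 *
      Real.exp (2 * s * slabWeight β a x₀ z)) (Ω ×ˢ Ioo a b) :=
    integrableOn_slab hbd (((hdv.continuousOn.clm_apply (hH2.prodMk continuousOn_const)).pow 2).mul
      hwc.continuousOn)
  have iT : IntegrableOn (fun z => fderiv ℝ F z (0, 1)) (Ω ×ˢ Ioo a b) :=
    integrableOn_slab hbd (hdF.clm_apply continuous_const).continuousOn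
  have iX : IntegrableOn (fun z => fderiv ℝ F z (H z.2, 0)) (Ω ×ˢ Ioo a b) :=
    integrableOn_slab hbd (hdF.continuousOn.clm_apply (hH2.prodMk continuousOn_const))
  have hpt : ∫ z in Ω ×ˢ Ioo a b, (s * κ * F z - (s * κ)⁻¹ * (fderiv ℝ v z (H z.2, 1) ^ 2 *
      Real.exp (2 * s * slabWeight β a x₀ z))) ≤
      ∫ z in Ω ×ˢ Ioo a b, (fderiv ℝ F z (0, 1) + fderiv ℝ F z (H z.2, 0)) := by
    refine setIntegral_mono_on ((iF.const_mul _).sub (iG.const_mul _)) (iT.add iX)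
      (hΩ.isOpen.measurableSet.prod measurableSet_Ioo) fun z hz => ?_
    have e : ((H z.2, 1) : RSpace d × ℝ) = (0, 1) + (H z.2, 0) := by simp
    rw [← map_add, ← e]
    exact le_fderiv_weightedSq β a x₀ s hv hs hκ
      (hslope z.2 (Ioo_subset_Icc_self hz.2) z.1 (subset_closure hz.1))
  rw [integral_sub (iF.const_mul _) (iG.const_mul _), integral_const_mul, integral_const_mul,
    integral_add iT iX, integral_time_deriv_slab hbd hab hF] at hpt
  have hM0 : 0 ≤ M := (norm_nonneg _).trans (hM a ⟨ha, hab.trans hb⟩)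
  obtain ⟨iE, hE⟩ := integral_exitSlab hΩ hH ha hb hF.continuous
  -- `H` does not depend on `x`, so at each fixed time `hK` bounds the spatial part by the exit
  -- integral.
  have hX : ∫ z in Ω ×ˢ Ioo a b, fderiv ℝ F z (H z.2, 0) ≤
      K * M * ∫ z in exitSlab Ω T H a b, F z ∂(lateralMeasure Ω T) := by
    have iX' : IntegrableOn (fun τ => ∫ x in Ω, fderiv ℝ F (x, τ) (H τ, 0)) (Ioo a b) := by
      rw [IntegrableOn, Measure.volume_eq_prod, ← Measure.prod_restrict] at iX
      exact iX.integral_prod_right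
    rw [setIntegral_slab_symm iX, hE, ← integral_const_mul]
    refine setIntegral_mono_on iX' (iE.const_mul _) measurableSet_Ioo fun τ hτ => ?_
    have hsl : ContDiff ℝ 1 fun y : RSpace d => F (y, τ) :=
      hF.comp (contDiff_id.prodMk contDiff_const)
    have h1 := hK (H τ) (fun y => F (y, τ)) hsl fun y => hF0 _
    have h2 : ∀ x, fderiv ℝ F (x, τ) (H τ, 0) = fderiv ℝ (fun y => F (y, τ)) x (H τ) := fun x =>
      (fderiv_slice (hF.differentiable (by simp)) (x, τ) (H τ)).symm
    simp only [h2]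
    refine h1.trans ?_
    have h3 : 0 ≤ ∫ p in exitSlice Ω (H τ), F (p, τ)
        ∂(Measure.euclideanHausdorffMeasure (d - 1)) := integral_nonneg fun p => hF0 _
    have h4 := hM τ ⟨ha.trans hτ.1.le, hτ.2.le.trans hb⟩
    gcongr
  have h5 := hpt.trans (add_le_add_right hX _)
  -- The extra factor `s` turns `sκ` into `s²κ` and makes the coefficient of `|Pv|²` independent of
  -- `s`.
  have h6 := mul_le_mul_of_nonneg_left h5 hs.le
  have h7 : s * (s * κ)⁻¹ = κ⁻¹ := by field_simp
  set A := ∫ z in Ω ×ˢ Ioo a b, F z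
  set B := ∫ z in Ω ×ˢ Ioo a b, fderiv ℝ v z (H z.2, 1) ^ 2 *
      Real.exp (2 * s * slabWeight β a x₀ z)
  have h8 : s * (s * κ * A - (s * κ)⁻¹ * B) = s ^ 2 * κ * A - κ⁻¹ * B := by
    rw [mul_sub, ← mul_assoc s (s * κ)⁻¹, h7]; ring
  rw [h8] at h6
  linarith

/-! ### Passage from smooth functions to `H¹` -/

section SquareNorm

variable {α : Type*} [MeasurableSpace α] {μ : Measure α}

theorem sq_eLpNorm_two (f : α → ℝ) : eLpNorm f 2 μ ^ 2 = ∫⁻ x, ENNReal.ofReal (f x ^ 2) ∂μ := by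
  have h := eLpNorm_nnreal_pow_eq_lintegral (μ := μ) (f := f) (p := 2) two_ne_zero
  have e : ((2 : NNReal) : ℝ) = ((2 : ℕ) : ℝ) := by norm_num
  simp only [e, ENNReal.rpow_natCast, ENNReal.coe_ofNat] at h
  rw [h]
  refine lintegral_congr fun x => ?_
  rw [Real.enorm_eq_ofReal_abs, ← ENNReal.ofReal_pow (abs_nonneg _), sq_abs]

theorem MeasureTheory.MemLp.sq_eLpNorm_two_eq {f : α → ℝ} (hf : MemLp f 2 μ) :
    eLpNorm f 2 μ ^ 2 = ENNReal.ofReal (∫ x, f x ^ 2 ∂μ) := by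
  rw [sq_eLpNorm_two, ofReal_integral_eq_lintegral_ofReal hf.integrable_sq
    (Eventually.of_forall fun x => sq_nonneg _)]

theorem MeasureTheory.MemLp.integral_sq_eq {f : α → ℝ} (hf : MemLp f 2 μ) :
    ∫ x, f x ^ 2 ∂μ = ‖hf.toLp f‖ ^ 2 := by
  rw [Lp.norm_toLp, ← ENNReal.toReal_pow, hf.sq_eLpNorm_two_eq,
    ENNReal.toReal_ofReal (integral_nonneg fun x => sq_nonneg _)]

theorem MeasureTheory.MemLp.eLpNorm_two_le {f : α → ℝ} (hf : MemLp f 2 μ) {ε : ℝ} (hε : 0 ≤ ε)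
    (h : ∫ x, f x ^ 2 ∂μ ≤ ε ^ 2) : eLpNorm f 2 μ ≤ ENNReal.ofReal ε := by
  rw [← ENNReal.pow_le_pow_left_iff two_ne_zero, hf.sq_eLpNorm_two_eq, ← ENNReal.ofReal_pow hε]
  exact ENNReal.ofReal_le_ofReal h

theorem tendsto_integral_sq {f : α → ℝ} {fn : ℕ → α → ℝ} (hf : MemLp f 2 μ)
    (hfn : ∀ n, MemLp (fn n) 2 μ)
    (h : Tendsto (fun n => eLpNorm (fun z => fn n z - f z) 2 μ) atTop (𝓝 0)) :
    Tendsto (fun n => ∫ z, fn n z ^ 2 ∂μ) atTop (𝓝 (∫ z, f z ^ 2 ∂μ)) := by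
  have h1 := (Lp.tendsto_Lp_iff_tendsto_eLpNorm'' fn hfn f hf).2 h
  simp only [MemLp.integral_sq_eq hf, fun n => MemLp.integral_sq_eq (hfn n)]
  exact h1.norm.pow 2

/-- Multiplication by `√w` is bounded on `L²`, which reduces the weighted case to the unweighted
one. -/
theorem tendsto_integral_sq_mul {f : α → ℝ} {fn : ℕ → α → ℝ} (hf : MemLp f 2 μ)
    (hfn : ∀ n, MemLp (fn n) 2 μ)
    (h : Tendsto (fun n => eLpNorm (fun z => fn n z - f z) 2 μ) atTop (𝓝 0))
    {w : α → ℝ} (hw : AEStronglyMeasurable w μ) (hw0 : ∀ z, 0 ≤ w z) {C : ℝ}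
    (hC : ∀ᵐ z ∂μ, w z ≤ C) :
    Tendsto (fun n => ∫ z, fn n z ^ 2 * w z ∂μ) atTop (𝓝 (∫ z, f z ^ 2 * w z ∂μ)) := by
  have hsq : AEStronglyMeasurable (fun z => Real.sqrt (w z)) μ :=
    Real.continuous_sqrt.comp_aestronglyMeasurable hw
  have hb : ∀ g : α → ℝ, ∀ᵐ z ∂μ, ‖Real.sqrt (w z) * g z‖ ≤ Real.sqrt C * ‖g z‖ := fun g => by
    filter_upwards [hC] with z hz
    rw [norm_mul, Real.norm_of_nonneg (Real.sqrt_nonneg _)]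
    exact mul_le_mul_of_nonneg_right (Real.sqrt_le_sqrt hz) (norm_nonneg _)
  have hm : ∀ g : α → ℝ, MemLp g 2 μ → MemLp (fun z => Real.sqrt (w z) * g z) 2 μ := fun g hg =>
    hg.of_le_mul (hsq.mul hg.1) (hb g)
  have key := tendsto_integral_sq (hm f hf) (fun n => hm _ (hfn n)) (by
    have h0 : Tendsto (fun n => ENNReal.ofReal (Real.sqrt C) *
        eLpNorm (fun z => fn n z - f z) 2 μ) atTop (𝓝 0) := by
      have := ENNReal.Tendsto.const_mul h (Or.inr (ENNReal.ofReal_ne_top (r := Real.sqrt C)))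
      rwa [mul_zero] at this
    refine tendsto_of_tendsto_of_tendsto_of_le_of_le tendsto_const_nhds h0 (fun _ => bot_le)
      fun n => ?_
    have := eLpNorm_le_mul_eLpNorm_of_ae_le_mul (hb fun z => fn n z - f z) 2
    simpa only [mul_sub] using this)
  have e : ∀ g : α → ℝ, ∫ z, (Real.sqrt (w z) * g z) ^ 2 ∂μ = ∫ z, g z ^ 2 * w z ∂μ := fun g =>
    integral_congr_ae (Eventually.of_forall fun z => by
      simp only [mul_pow, Real.sq_sqrt (hw0 z)]; ring)
  simpa only [e] using key

end SquareNorm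

/-- Cauchy–Schwarz, obtained by expanding the integral of the squared deviation of `g` from its
mean. -/
theorem sq_intervalIntegral_le {g : ℝ → ℝ} (hg : Continuous g) {a b : ℝ} (hab : a ≤ b) :
    (∫ x in a..b, g x) ^ 2 ≤ (b - a) * ∫ x in a..b, g x ^ 2 := by
  rcases hab.eq_or_lt with rfl | hlt
  · simp
  have hl : 0 < b - a := sub_pos.2 hlt
  set I := ∫ x in a..b, g x with hI
  have h0 : 0 ≤ ∫ x in a..b, (g x - I / (b - a)) ^ 2 :=
    intervalIntegral.integral_nonneg hab fun x _ => sq_nonneg _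
  have e : ∫ x in a..b, (g x - I / (b - a)) ^ 2 =
      (∫ x in a..b, g x ^ 2) - I ^ 2 / (b - a) := by
    have e1 : ∀ x, (g x - I / (b - a)) ^ 2 =
        g x ^ 2 - 2 * (I / (b - a)) * g x + (I / (b - a)) ^ 2 := fun x => by ring
    have i1 : IntervalIntegrable (fun x => g x ^ 2) volume a b :=
      (hg.pow 2).intervalIntegrable _ _
    have i2 : IntervalIntegrable (fun x => 2 * (I / (b - a)) * g x) volume a b :=
      (continuous_const.mul hg).intervalIntegrable _ _
    simp only [e1]
    rw [intervalIntegral.integral_add (i1.sub i2) (continuous_const.intervalIntegrable _ _),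
      intervalIntegral.integral_sub i1 i2,
      intervalIntegral.integral_const_mul, intervalIntegral.integral_const, ← hI, smul_eq_mul]
    field_simp
    ring
  rw [e, sub_nonneg, div_le_iff₀ hl] at h0
  linarith

/-- Fundamental theorem of calculus and Cauchy–Schwarz in time. The slices are 1/2-Hölder in time
with values in `L²(Ω)`, with a constant controlled by `∂ₜv`, hence uniformly along an
`H¹`-convergent sequence. -/
theorem integral_sq_time_diff_le {d : ℕ} {Ω : Set (RSpace d)} (hΩ : IsOpen Ω)
    (hb : Bornology.IsBounded Ω) {T : ℝ} {v : RSpace d × ℝ → ℝ} (hv : ContDiff ℝ ∞ v) {σ τ : ℝ}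
    (hσ : σ ∈ Icc 0 T) (hτ : τ ∈ Icc 0 T) :
    ∫ x in Ω, (v (x, τ) - v (x, σ)) ^ 2 ≤
      |τ - σ| * ∫ z in Ω ×ˢ Ioo 0 T, fderiv ℝ v z (0, 1) ^ 2 := by
  wlog hle : σ ≤ τ generalizing σ τ
  · have := this hτ hσ (le_of_not_ge hle)
    rw [abs_sub_comm] at this
    refine le_trans (le_of_eq ?_) this
    exact integral_congr_ae (Eventually.of_forall fun x => by simp only; ring)
  have hc : Continuous fun z => fderiv ℝ v z (0, 1) :=
    (hv.continuous_fderiv (by simp)).clm_apply continuous_const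
  have hsub : Ω ×ˢ Ioo σ τ ⊆ Ω ×ˢ Ioo 0 T := prod_mono le_rfl (Ioo_subset_Ioo hσ.1 hτ.2)
  have h1 : ∫ z in Ω ×ˢ Ioo σ τ, fderiv ℝ v z (0, 1) ^ 2 ≤
      ∫ z in Ω ×ˢ Ioo 0 T, fderiv ℝ v z (0, 1) ^ 2 :=
    setIntegral_mono_set (integrableOn_slab hb (hc.pow 2).continuousOn)
      (Eventually.of_forall fun z => sq_nonneg _) (LE.le.eventuallyLE hsub)
  rw [abs_of_nonneg (sub_nonneg.2 hle)]
  refine le_trans ?_ (mul_le_mul_of_nonneg_left h1 (sub_nonneg.2 hle))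
  have i2 : IntegrableOn (fun z => fderiv ℝ v z (0, 1) ^ 2) (Ω ×ˢ Ioo σ τ) :=
    integrableOn_slab hb (hc.pow 2).continuousOn
  rw [setIntegral_slab i2, ← integral_const_mul]
  have i3 : IntegrableOn (fun x => ∫ τ in Ioo σ τ, fderiv ℝ v (x, τ) (0, 1) ^ 2) Ω := by
    rw [IntegrableOn, Measure.volume_eq_prod, ← Measure.prod_restrict] at i2
    exact i2.integral_prod_left
  have hvx : ∀ c : ℝ, Continuous fun x => v (x, c) := fun c =>
    hv.continuous.comp (by fun_prop : Continuous fun x : RSpace d => (x, c))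
  refine setIntegral_mono_on ((((hvx τ).sub (hvx σ)).pow 2).integrableOn_of_isBounded hb)
    (i3.const_mul _) hΩ.measurableSet fun x _ => ?_
  rw [← integral_Ioc_eq_integral_Ioo, ← intervalIntegral.integral_of_le hle,
    ← intervalIntegral.integral_eq_sub_of_hasDerivAt (fun c _ =>
      hasDerivAt_time_slice (hv.differentiable (by simp)) x c)
      ((hc.comp (by fun_prop)).intervalIntegrable _ _)]
  exact sq_intervalIntegral_le (hc.comp (by fun_prop)) hle

theorem memLp_slab {d : ℕ} {Ω : Set (RSpace d)} (hΩ : IsOpen Ω) (hb : Bornology.IsBounded Ω)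
    {a b : ℝ} {f : RSpace d × ℝ → ℝ} (hf : ContinuousOn f (closure Ω ×ˢ Icc a b)) :
    MemLp f 2 (volume.restrict (Ω ×ˢ Ioo a b)) := by
  have hcomp := hb.isCompact_closure.prod (isCompact_Icc (a := a) (b := b))
  have hsub : Ω ×ˢ Ioo a b ⊆ closure Ω ×ˢ Icc a b :=
    prod_mono subset_closure Ioo_subset_Icc_self
  have hfin : IsFiniteMeasure (volume.restrict (Ω ×ˢ Ioo a b)) :=
    ⟨by simpa using (measure_mono hsub).trans_lt hcomp.measure_lt_top⟩
  obtain ⟨C, hC⟩ := (hcomp.image_of_continuousOn hf).isBounded.exists_norm_le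
  have hm := hΩ.measurableSet.prod (measurableSet_Ioo (a := a) (b := b))
  exact MemLp.of_bound ((hf.mono hsub).aestronglyMeasurable hm) C
    (ae_restrict_of_forall_mem hm fun z hz => hC _ ⟨z, hsub hz, rfl⟩)

theorem Continuous.memLp_of_isBounded {d : ℕ} {Ω : Set (RSpace d)} (hΩ : IsOpen Ω)
    (hb : Bornology.IsBounded Ω) {f : RSpace d → ℝ} (hf : Continuous f) :
    MemLp f 2 (volume.restrict Ω) := by
  have hfin : IsFiniteMeasure (volume.restrict Ω) :=
    ⟨by simpa using hb.measure_lt_top⟩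
  obtain ⟨C, hC⟩ := (hb.isCompact_closure.image hf).isBounded.exists_norm_le
  exact MemLp.of_bound hf.aestronglyMeasurable C
    (ae_restrict_of_forall_mem hΩ.measurableSet fun z hz => hC _ ⟨z, subset_closure hz, rfl⟩)

/-- The time slices of smooth approximations in `H¹` converge in `L²(Ω)`, at every time. -/
theorem tendsto_time_slice {d : ℕ} {Ω : Set (RSpace d)} (hΩ : IsOpen Ω)
    (hb : Bornology.IsBounded Ω) {T : ℝ} (hT : 0 < T) {u ut : RSpace d × ℝ → ℝ}
    {Du : RSpace d × ℝ → RSpace d} (hu : MemLp u 2 (volume.restrict (spaceTimeCylinder Ω T)))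
    (hut : MemLp ut 2 (volume.restrict (spaceTimeCylinder Ω T)))
    {v : ℕ → RSpace d × ℝ → ℝ} (hv : TendstoInH1 (spaceTimeCylinder Ω T) v u ut Du)
    {U : ℝ → Lp ℝ 2 ((volume : Measure (RSpace d)).restrict Ω)} (hU : IsTimeSlices Ω T u U)
    {t : ℝ} (ht : t ∈ Icc 0 T) :
    Tendsto (fun n => eLpNorm (fun x => v n (x, t) - U t x) 2 (volume.restrict Ω))
      atTop (𝓝 0) := by
  have hcd : ∀ n, Continuous fun z => fderiv ℝ (v n) z (0, 1) := fun n =>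
    ((hv.smooth n).continuous_fderiv (by simp)).clm_apply continuous_const
  have hsl : ∀ n c, Continuous fun x => v n (x, c) := fun n c =>
    (hv.smooth n).continuous.comp (by fun_prop : Continuous fun x : RSpace d => (x, c))
  have hM := tendsto_integral_sq hut
    (fun n => memLp_slab hΩ hb (hcd n).continuousOn) hv.tendsto_time
  set M := (∫ z in spaceTimeCylinder Ω T, ut z ^ 2) + 1 with hMd
  have hMev := hM.eventually_le_const (lt_add_one _)
  have hM0 : 0 < M := add_pos_of_nonneg_of_pos (integral_nonneg fun z => sq_nonneg _) one_pos
  rw [ENNReal.tendsto_nhds_zero]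
  intro ε' hε'
  obtain ⟨ε, hε, hεε⟩ : ∃ ε : ℝ, 0 < ε ∧ ENNReal.ofReal ε * 3 ≤ ε' := by
    obtain ⟨c, hc0, hc⟩ := ENNReal.lt_iff_exists_nnreal_btwn.1 hε'
    refine ⟨c / 3, by have : 0 < c := by exact_mod_cast hc0
                      positivity, ?_⟩
    refine le_trans (le_of_eq ?_) hc.le
    rw [← ENNReal.ofReal_ofNat 3, ← ENNReal.ofReal_mul (by positivity), div_mul_cancel₀ _
      (by norm_num), ENNReal.ofReal_coe_nnreal]
  obtain ⟨ρ, hρ, hρU⟩ := Metric.continuousWithinAt_iff.1 (hU.continuousOn t ht) ε hε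
  -- Within `ρ'` of `t`, both `U` and every `v n` whose squared time derivative integrates to at
  -- most `M` move by at most `ε` in `L²(Ω)`.
  set ρ' := min ρ (ε ^ 2 / M) with hρ'
  have hρ'0 : 0 < ρ' := lt_min hρ (by positivity)
  set J := Ioo (max 0 (t - ρ')) (min T (t + ρ')) with hJ
  have hJlt : max 0 (t - ρ') < min T (t + ρ') :=
    max_lt (lt_min hT (by linarith [ht.1])) (lt_min (by linarith [ht.2]) (by linarith))
  have hJT : J ⊆ Ioo 0 T := Ioo_subset_Ioo (le_max_left _ _) (min_le_left _ _)
  have hJt : ∀ τ ∈ J, |t - τ| < ρ' := fun τ hτ => by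
    have h1 := (le_max_right _ _).trans_lt hτ.1
    have h2 := hτ.2.trans_le (min_le_right _ _)
    rw [abs_lt]; constructor <;> linarith
  have hJvol : 0 < volume J := by
    rw [hJ, Real.volume_Ioo]; simpa using hJlt
  set c : ENNReal := ENNReal.ofReal ε ^ 2 * volume J with hc
  have hc0 : 0 < c := by
    refine ENNReal.mul_pos (pow_ne_zero _ ?_) hJvol.ne'
    simpa using hε
  have hsq : Tendsto (fun n => eLpNorm (fun z => v n z - u z) 2
      (volume.restrict (spaceTimeCylinder Ω T)) ^ 2) atTop (𝓝 0) := by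
    simpa using ENNReal.Tendsto.pow (n := 2) hv.tendsto
  have hQ : (volume : Measure (RSpace d × ℝ)).restrict (spaceTimeCylinder Ω T) =
      ((volume : Measure (RSpace d)).restrict Ω).prod ((volume : Measure ℝ).restrict (Ioo 0 T)) := by
    rw [Measure.prod_restrict]; rfl
  filter_upwards [hMev, hsq.eventually_lt_const hc0] with n hn1 hn2
  have hum := hu.1
  rw [hQ] at hum
  have hdm : AEMeasurable (fun z => ENNReal.ofReal ((v n z - u z) ^ 2))
      (((volume : Measure (RSpace d)).restrict Ω).prod
        ((volume : Measure ℝ).restrict (Ioo 0 T))) :=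
    (((hv.smooth n).continuous.aestronglyMeasurable.sub hum).aemeasurable.pow_const 2).ennreal_ofReal
  rw [sq_eLpNorm_two, hQ, lintegral_prod_symm _ hdm] at hn2
  have hgood : ∀ᵐ τ ∂((volume : Measure ℝ).restrict (Ioo 0 T)),
      (U τ : RSpace d → ℝ) =ᵐ[(volume : Measure (RSpace d)).restrict Ω] fun x => u (x, τ) :=
    hU.ae_eq
  -- Convergence in `L²(Q)` controls slices only for most times, so a nearby good time `τ` is
  -- chosen. If none existed, the squared slice error would exceed `ε²` almost everywhere on `J`,
  -- and the total error would be at least `c`.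
  have hex : ∃ τ ∈ J, ((U τ : RSpace d → ℝ) =ᵐ[(volume : Measure (RSpace d)).restrict Ω]
      fun x => u (x, τ)) ∧ eLpNorm (fun x => v n (x, τ) - u (x, τ)) 2 (volume.restrict Ω) ≤
        ENNReal.ofReal ε := by
    by_contra hno
    push Not at hno
    refine absurd hn2 (not_lt.2 ?_)
    calc c = ∫⁻ _ in J, ENNReal.ofReal ε ^ 2 := by rw [setLIntegral_const]
      _ ≤ ∫⁻ τ in J, ∫⁻ x in Ω, ENNReal.ofReal ((v n (x, τ) - u (x, τ)) ^ 2) := by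
          refine lintegral_mono_ae ?_
          filter_upwards [ae_restrict_of_ae_restrict_of_subset hJT hgood,
            ae_restrict_mem measurableSet_Ioo] with τ h1 h2
          rw [← sq_eLpNorm_two fun x => v n (x, τ) - u (x, τ)]
          exact pow_le_pow_left' (hno τ h2 h1).le 2
      _ ≤ _ := lintegral_mono_set hJT
  obtain ⟨τ, hτJ, hτU, hτε⟩ := hex
  have hτT : τ ∈ Icc 0 T := Ioo_subset_Icc_self (hJT hτJ)
  have hdist := hJt τ hτJ
  have h1 : eLpNorm (fun x => v n (x, t) - v n (x, τ)) 2 (volume.restrict Ω) ≤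
      ENNReal.ofReal ε := by
    refine MemLp.eLpNorm_two_le
      (((hsl n t).sub (hsl n τ)).memLp_of_isBounded hΩ hb) hε.le ?_
    refine (integral_sq_time_diff_le hΩ hb (hv.smooth n) hτT ht).trans ?_
    calc |t - τ| * _ ≤ ε ^ 2 / M * M :=
          mul_le_mul (hdist.le.trans (min_le_right _ _)) hn1
            (integral_nonneg fun z => sq_nonneg _) (by positivity)
      _ = ε ^ 2 := div_mul_cancel₀ _ hM0.ne'
  have h3 : eLpNorm (fun x => U τ x - U t x) 2 (volume.restrict Ω) ≤ ENNReal.ofReal ε := by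
    have h4 := hρU hτT (by
      rw [Real.dist_eq, abs_sub_comm]; exact hdist.trans_le (min_le_left _ _))
    have h5 : edist (U τ) (U t) ≤ ENNReal.ofReal ε := by
      rw [edist_dist]; exact ENNReal.ofReal_le_ofReal h4.le
    rwa [Lp.edist_def] at h5
  have h2m : AEStronglyMeasurable (fun x => v n (x, τ) - u (x, τ)) (volume.restrict Ω) :=
    (hsl n τ).aestronglyMeasurable.sub ((Lp.aestronglyMeasurable (U τ)).congr hτU)
  -- Three errors of size `ε`: from `t` to `τ` for `v n`, from `v n` to `u` at `τ`, and back from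
  -- `τ` to `t` for `U`.
  have hae : (fun x => v n (x, t) - U t x) =ᵐ[volume.restrict Ω]
      ((fun x => v n (x, t) - v n (x, τ)) + fun x => v n (x, τ) - u (x, τ)) +
        fun x => U τ x - U t x := by
    filter_upwards [hτU] with x hx
    simp only [Pi.add_apply, hx]
    ring
  rw [eLpNorm_congr_ae hae]
  have h1m := ((hsl n t).sub (hsl n τ)).aestronglyMeasurable (μ := volume.restrict Ω)
  refine (eLpNorm_add_le (h1m.add h2m) ((Lp.aestronglyMeasurable _).sub
    (Lp.aestronglyMeasurable _)) one_le_two).trans ?_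
  refine (add_le_add ((eLpNorm_add_le h1m h2m one_le_two).trans (add_le_add h1 hτε)) h3).trans ?_
  refine le_trans (le_of_eq ?_) hεε
  ring

theorem memLp_transportOp {d : ℕ} {Ω : Set (RSpace d)} (hΩ : IsOpen Ω) {T M : ℝ}
    {H : ℝ → RSpace d} (hH : ContinuousOn H (Icc 0 T)) (hM : ∀ τ ∈ Icc 0 T, ‖H τ‖ ≤ M)
    {ut : RSpace d × ℝ → ℝ} {Du : RSpace d × ℝ → RSpace d}
    (hut : MemLp ut 2 (volume.restrict (spaceTimeCylinder Ω T)))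
    (hDu : MemLp Du 2 (volume.restrict (spaceTimeCylinder Ω T))) :
    MemLp (transportOp H ut Du) 2 (volume.restrict (spaceTimeCylinder Ω T)) := by
  have hm : MeasurableSet (spaceTimeCylinder Ω T) := hΩ.measurableSet.prod measurableSet_Ioo
  have hHm : AEStronglyMeasurable (fun z : RSpace d × ℝ => H z.2)
      (volume.restrict (spaceTimeCylinder Ω T)) :=
    ContinuousOn.aestronglyMeasurable
      (hH.comp continuousOn_snd fun z hz => Ioo_subset_Icc_self hz.2) hm
  refine hut.add (hDu.of_le_mul (hHm.inner hDu.1) (c := M) ?_)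
  refine ae_restrict_of_forall_mem hm fun z hz => (norm_inner_le_norm _ _).trans ?_
  exact mul_le_mul_of_nonneg_right (hM _ (Ioo_subset_Icc_self hz.2)) (norm_nonneg _)

theorem tendsto_transportOp {d : ℕ} {Ω : Set (RSpace d)} (hΩ : IsOpen Ω)
    {T M : ℝ} {H : ℝ → RSpace d} (hH : ContinuousOn H (Icc 0 T))
    (hM : ∀ τ ∈ Icc 0 T, ‖H τ‖ ≤ M) {u ut : RSpace d × ℝ → ℝ} {Du : RSpace d × ℝ → RSpace d}
    (hut : MemLp ut 2 (volume.restrict (spaceTimeCylinder Ω T)))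
    (hDu : MemLp Du 2 (volume.restrict (spaceTimeCylinder Ω T)))
    {v : ℕ → RSpace d × ℝ → ℝ} (hv : TendstoInH1 (spaceTimeCylinder Ω T) v u ut Du) :
    Tendsto (fun n => eLpNorm (fun z => fderiv ℝ (v n) z (H z.2, 1) - transportOp H ut Du z) 2
      (volume.restrict (spaceTimeCylinder Ω T))) atTop (𝓝 0) := by
  set μ := (volume : Measure (RSpace d × ℝ)).restrict (spaceTimeCylinder Ω T) with hμ
  have hm : MeasurableSet (spaceTimeCylinder Ω T) := hΩ.measurableSet.prod measurableSet_Ioo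
  have hHm : AEStronglyMeasurable (fun z : RSpace d × ℝ => H z.2) μ :=
    ContinuousOn.aestronglyMeasurable
      (hH.comp continuousOn_snd fun z hz => Ioo_subset_Icc_self hz.2) hm
  have hdv : ∀ n, Continuous (fderiv ℝ (v n)) := fun n =>
    (hv.smooth n).continuous_fderiv (by simp)
  have hgrad : ∀ n, Continuous fun z : RSpace d × ℝ => gradient (fun y => v n (y, z.2)) z.1 := by
    intro n
    have e : ∀ z : RSpace d × ℝ, fderiv ℝ (fun y => v n (y, z.2)) z.1 =
        (fderiv ℝ (v n) z).comp (ContinuousLinearMap.inl ℝ (RSpace d) ℝ) := fun z => by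
      ext1 a
      rw [fderiv_slice ((hv.smooth n).differentiable (by simp))]
      simp
    simp only [gradient, e]
    exact (InnerProductSpace.toDual ℝ (RSpace d)).symm.continuous.comp
      ((hdv n).clm_comp continuous_const)
  have hlim : Tendsto (fun n => eLpNorm (fun z => fderiv ℝ (v n) z (0, 1) - ut z) 2 μ +
      ENNReal.ofReal M * eLpNorm (fun z => gradient (fun y => v n (y, z.2)) z.1 - Du z) 2 μ)
      atTop (𝓝 0) := by
    have := hv.tendsto_time.add (ENNReal.Tendsto.const_mul hv.tendsto_space
      (Or.inr (ENNReal.ofReal_ne_top (r := M))))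
    simpa using this
  refine tendsto_of_tendsto_of_tendsto_of_le_of_le tendsto_const_nhds hlim (fun _ => bot_le)
    fun n => ?_
  have e : (fun z => fderiv ℝ (v n) z (H z.2, 1) - transportOp H ut Du z) =
      (fun z => fderiv ℝ (v n) z (0, 1) - ut z) +
        fun z => inner ℝ (H z.2) (gradient (fun y => v n (y, z.2)) z.1 - Du z) := by
    funext z
    rw [← transportOp_smooth ((hv.smooth n).differentiable (by simp))]
    simp only [transportOp, Pi.add_apply, inner_sub_right]
    ring
  rw [e]
  refine (eLpNorm_add_le ((((hdv n).clm_apply continuous_const).aestronglyMeasurable).sub hut.1)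
    (hHm.inner ((hgrad n).aestronglyMeasurable.sub hDu.1)) one_le_two).trans ?_
  refine add_le_add le_rfl (eLpNorm_le_mul_eLpNorm_of_ae_le_mul ?_ 2)
  refine ae_restrict_of_forall_mem hm fun z hz => (norm_inner_le_norm _ _).trans ?_
  exact mul_le_mul_of_nonneg_right (hM _ (Ioo_subset_Icc_self hz.2)) (norm_nonneg _)

/-- The energy inequality on a slab, in `H¹`. -/
theorem slab_estimate {d : ℕ} {Ω : Set (RSpace d)} (hΩ : IsSmoothBoundedDomain Ω) {T : ℝ}
    (hT : 0 < T) {H : ℝ → RSpace d} (hH : ContinuousOn H (Icc 0 T)) {K M : ℝ} (hK0 : 0 ≤ K)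
    (hK : ∀ (a : RSpace d) (F : RSpace d → ℝ), ContDiff ℝ 1 F → (∀ x, 0 ≤ F x) →
      ∫ x in Ω, fderiv ℝ F x a ≤
        K * ‖a‖ * ∫ p in exitSlice Ω a, F p ∂(Measure.euclideanHausdorffMeasure (d - 1)))
    (hM : ∀ τ ∈ Icc 0 T, ‖H τ‖ ≤ M) {a b : ℝ} (ha : 0 ≤ a) (hab : a ≤ b) (hb : b ≤ T)
    {β : ℝ} {x₀ : RSpace d} {κ : ℝ} (hκ : 0 < κ)
    (hslope : ∀ τ ∈ Icc a b, ∀ x ∈ closure Ω, κ ≤ -β + 2 * inner ℝ (H τ) (x - x₀))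
    {u ut : RSpace d × ℝ → ℝ} {Du : RSpace d × ℝ → RSpace d}
    (hu : IsH1WithDerivs (spaceTimeCylinder Ω T) u ut Du) {g : RSpace d × ℝ → ℝ}
    (hg : IsLateralTrace Ω T u ut Du g)
    {U : ℝ → Lp ℝ 2 ((volume : Measure (RSpace d)).restrict Ω)} (hU : IsTimeSlices Ω T u U)
    {s : ℝ} (hs : 0 < s) :
    s ^ 2 * κ * (∫ z in Ω ×ˢ Ioo a b, u z ^ 2 * Real.exp (2 * s * slabWeight β a x₀ z))
        + s * ∫ x in Ω, U a x ^ 2 * Real.exp (2 * s * slabWeight β a x₀ (x, a)) ≤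
      κ⁻¹ * (∫ z in Ω ×ˢ Ioo a b, transportOp H ut Du z ^ 2 *
          Real.exp (2 * s * slabWeight β a x₀ z))
        + s * (∫ x in Ω, U b x ^ 2 * Real.exp (2 * s * slabWeight β a x₀ (x, b)))
        + s * (K * M * ∫ z in exitSlab Ω T H a b, g z ^ 2 *
            Real.exp (2 * s * slabWeight β a x₀ z) ∂(lateralMeasure Ω T)) := by
  -- The definition of the trace supplies a single smooth sequence, and it serves for all five
  -- integrals.
  obtain ⟨hg2, v, hv, hvg⟩ := hg
  have hbd := hΩ.isBounded
  have hwc : Continuous fun z => Real.exp (2 * s * slabWeight β a x₀ z) :=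
    Real.continuous_exp.comp (continuous_const.mul
      (contDiff_slabWeight (n := 1) β a x₀).continuous)
  obtain ⟨C, hC⟩ := ((hbd.isCompact_closure.prod (isCompact_Icc (a := 0) (b := T))).image
    hwc).isBounded.exists_norm_le
  have hCw : ∀ z ∈ closure Ω ×ˢ Icc 0 T, Real.exp (2 * s * slabWeight β a x₀ z) ≤ C :=
    fun z hz => (le_abs_self _).trans (hC _ ⟨z, hz, rfl⟩)
  have hsub : Ω ×ˢ Ioo a b ⊆ spaceTimeCylinder Ω T :=
    prod_mono le_rfl (Ioo_subset_Ioo ha hb)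
  have hms := Measure.restrict_mono (μ := (volume : Measure (RSpace d × ℝ))) hsub le_rfl
  have hmQ : MeasurableSet (Ω ×ˢ Ioo a b) := hΩ.isOpen.measurableSet.prod measurableSet_Ioo
  have hsmall : ∀ f : ℕ → RSpace d × ℝ → ℝ, Tendsto (fun n => eLpNorm (f n) 2
      (volume.restrict (spaceTimeCylinder Ω T))) atTop (𝓝 0) →
      Tendsto (fun n => eLpNorm (f n) 2 (volume.restrict (Ω ×ˢ Ioo a b))) atTop (𝓝 0) :=
    fun f hf => tendsto_of_tendsto_of_tendsto_of_le_of_le tendsto_const_nhds hf (fun _ => bot_le)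
      fun n => eLpNorm_mono_measure _ hms
  have hCQ : ∀ᵐ z ∂(volume.restrict (Ω ×ˢ Ioo a b)),
      Real.exp (2 * s * slabWeight β a x₀ z) ≤ C :=
    ae_restrict_of_forall_mem hmQ fun z hz => hCw z
      ⟨subset_closure hz.1, Ioo_subset_Icc_self (hsub hz).2⟩
  have hH2 : ContinuousOn (fun z : RSpace d × ℝ => H z.2) (closure Ω ×ˢ Icc a b) :=
    (hH.mono (Icc_subset_Icc ha hb)).comp continuousOn_snd fun z hz => hz.2
  have l1 := tendsto_integral_sq_mul (hu.memLp.mono_measure hms)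
    (fun n => memLp_slab hΩ.isOpen hbd (hv.smooth n).continuous.continuousOn)
    (hsmall _ hv.tendsto) hwc.aestronglyMeasurable (fun z => (Real.exp_pos _).le) hCQ
  have l2 := tendsto_integral_sq_mul
    ((memLp_transportOp hΩ.isOpen hH hM hu.memLp_time hu.memLp_space).mono_measure hms)
    (fun n => memLp_slab hΩ.isOpen hbd
      (((hv.smooth n).continuous_fderiv (by simp)).continuousOn.clm_apply
        (hH2.prodMk continuousOn_const)))
    (hsmall _ (tendsto_transportOp hΩ.isOpen hH hM hu.memLp_time hu.memLp_space hv))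
    hwc.aestronglyMeasurable (fun z => (Real.exp_pos _).le) hCQ
  have lslice : ∀ c ∈ Icc 0 T, Tendsto (fun n => ∫ x in Ω, v n (x, c) ^ 2 *
      Real.exp (2 * s * slabWeight β a x₀ (x, c))) atTop
      (𝓝 (∫ x in Ω, U c x ^ 2 * Real.exp (2 * s * slabWeight β a x₀ (x, c)))) := by
    intro c hc
    have hsl : Continuous fun x : RSpace d => (x, c) := by fun_prop
    refine tendsto_integral_sq_mul (Lp.memLp (U c)) (fun n =>
      ((hv.smooth n).continuous.comp hsl).memLp_of_isBounded hΩ.isOpen hbd)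
      (tendsto_time_slice hΩ.isOpen hbd hT hu.memLp hu.memLp_time hv hU hc)
      (hwc.comp hsl).aestronglyMeasurable (fun z => (Real.exp_pos _).le) (C := C) ?_
    exact ae_restrict_of_forall_mem hΩ.isOpen.measurableSet fun x hx =>
      hCw _ ⟨subset_closure hx, hc⟩
  have l3 := lslice a ⟨ha, hab.trans hb⟩
  have l4 := lslice b ⟨ha.trans hab, hb⟩
  have hfinL := isFiniteMeasure_lateralMeasure hΩ T
  have hmsL : (lateralMeasure Ω T).restrict (exitSlab Ω T H a b) ≤ lateralMeasure Ω T :=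
    Measure.restrict_le_self
  have haeL := ae_lateralMeasure_mem hΩ T
  have hmemL : ∀ n, MemLp (v n) 2 (lateralMeasure Ω T) := fun n => by
    have hc := (hv.smooth n).continuous
    obtain ⟨C', hC'⟩ := ((hbd.isCompact_closure.prod (isCompact_Icc (a := 0) (b := T))).image
      hc).isBounded.exists_norm_le
    refine MemLp.of_bound hc.aestronglyMeasurable C' ?_
    filter_upwards [haeL] with z hz using hC' _ ⟨z, hz, rfl⟩
  have l5 := tendsto_integral_sq_mul (hg2.mono_measure hmsL)
    (fun n => (hmemL n).mono_measure hmsL)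
    (tendsto_of_tendsto_of_tendsto_of_le_of_le tendsto_const_nhds hvg (fun _ => bot_le)
      fun n => eLpNorm_mono_measure _ hmsL)
    hwc.aestronglyMeasurable (fun z => (Real.exp_pos _).le) (C := C)
    (ae_restrict_of_ae (by filter_upwards [haeL] with z hz using hCw z hz))
  refine le_of_tendsto_of_tendsto' ((l1.const_mul (s ^ 2 * κ)).add (l3.const_mul s))
    (((l2.const_mul κ⁻¹).add (l4.const_mul s)).add ((l5.const_mul (K * M)).const_mul s))
    fun n => ?_
  exact slab_estimate_smooth hΩ hH hK0 hK hM ha hab hb hκ hslope (hv.smooth n) hs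

/-! ### Decomposition into slabs and summation -/

theorem integrable_sq_mul {α : Type*} [MeasurableSpace α] {μ : Measure α} {f w : α → ℝ}
    (hf : MemLp f 2 μ) (hw : AEStronglyMeasurable w μ) (hw0 : ∀ z, 0 ≤ w z) {C : ℝ}
    (hC : ∀ᵐ z ∂μ, w z ≤ C) : Integrable (fun z => f z ^ 2 * w z) μ := by
  refine (hf.integrable_sq.mul_const C).mono' ((hf.1.pow 2).mul hw) ?_
  filter_upwards [hC] with z hz
  rw [Real.norm_of_nonneg (mul_nonneg (sq_nonneg _) (hw0 z))]
  exact mul_le_mul_of_nonneg_left hz (sq_nonneg _)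

theorem prod_Ioo_ae_eq_prod_Ioc {d : ℕ} (Ω : Set (RSpace d)) (a b : ℝ) :
    (Ω ×ˢ Ioo a b : Set (RSpace d × ℝ)) =ᵐ[volume] (Ω ×ˢ Ioc a b : Set (RSpace d × ℝ)) := by
  rw [Measure.volume_eq_prod]
  exact Measure.set_prod_ae_eq (EventuallyEq.refl _ _) Ioo_ae_eq_Ioc

theorem IsTimePartition.integral_cylinder_eq_sum {d : ℕ} {Ω : Set (RSpace d)} (hΩ : IsOpen Ω)
    {T : ℝ} {m : ℕ} {t : ℕ → ℝ} (ht : IsTimePartition T m t) {f : RSpace d × ℝ → ℝ}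
    (hf : ∀ j < m, IntegrableOn f (Ω ×ˢ Ioo (t j) (t (j + 1)))) :
    ∫ z in spaceTimeCylinder Ω T, f z =
      ∑ j ∈ Finset.range m, ∫ z in Ω ×ˢ Ioo (t j) (t (j + 1)), f z := by
  -- Half-open intervals tile exactly, which suits the induction; they differ from the open ones by
  -- null sets.
  have key : ∀ k ≤ m, IntegrableOn f (Ω ×ˢ Ioc (t 0) (t k)) ∧ ∫ z in Ω ×ˢ Ioc (t 0) (t k), f z =
      ∑ j ∈ Finset.range k, ∫ z in Ω ×ˢ Ioo (t j) (t (j + 1)), f z := by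
    intro k
    induction k with
    | zero => intro _; simp
    | succ k ih =>
      intro hk
      obtain ⟨h1, h2⟩ := ih (by omega)
      have h3 : IntegrableOn f (Ω ×ˢ Ioc (t k) (t (k + 1))) :=
        (hf k (by omega)).congr_set_ae (prod_Ioo_ae_eq_prod_Ioc Ω _ _).symm
      have hU : Ω ×ˢ Ioc (t 0) (t (k + 1)) =
          Ω ×ˢ Ioc (t 0) (t k) ∪ Ω ×ˢ Ioc (t k) (t (k + 1)) := by
        rw [← prod_union, Ioc_union_Ioc_eq_Ioc (ht.le (Nat.zero_le k) (by omega))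
          (ht.lt_succ k (by omega)).le]
      have hdis : Disjoint (Ω ×ˢ Ioc (t 0) (t k)) (Ω ×ˢ Ioc (t k) (t (k + 1))) :=
        disjoint_left.2 fun z hz hz' => absurd hz.2.2 (not_le.2 hz'.2.1)
      rw [hU]
      refine ⟨h1.union h3, ?_⟩
      rw [setIntegral_union hdis (hΩ.measurableSet.prod measurableSet_Ioc) h1 h3, h2,
        Finset.sum_range_succ, setIntegral_congr_set (prod_Ioo_ae_eq_prod_Ioc Ω (t k) (t (k + 1)))]
  have := (key m le_rfl).2
  rw [ht.zero, ht.last] at this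
  rw [← this, spaceTimeCylinder, setIntegral_congr_set (prod_Ioo_ae_eq_prod_Ioc Ω 0 T)]

theorem weight_eq_weightPiece {d : ℕ} {Ω : Set (RSpace d)} {T S r : ℝ} {H : ℝ → RSpace d} {m : ℕ}
    {t : ℕ → ℝ} (ht : IsTimePartition T m t) {j : ℕ} (hj : j < m) {z : RSpace d × ℝ}
    (hz : z.2 ∈ Ico (t j) (t (j + 1))) :
    weight Ω T S r H m t z = weightPiece Ω T S r H t j z := by
  have hT : z.2 < T := hz.2.trans_le (ht.mem_Icc (j := j + 1) hj).2
  rw [weight, if_pos hT, Finset.sum_eq_single_of_mem j (Finset.mem_range.2 hj), if_pos hz]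
  intro i hi hij
  have hi := Finset.mem_range.1 hi
  rw [if_neg]
  rintro ⟨h1, h2⟩
  rcases lt_or_gt_of_ne hij with h | h
  · exact absurd (h2.trans_le (ht.le (Nat.succ_le_of_lt h) hj.le)) (not_lt.2 hz.1)
  · exact absurd (hz.2.trans_le (ht.le (Nat.succ_le_of_lt h) hi.le)) (not_lt.2 h1)

/-- Summation of the slab inequalities. -/
theorem sum_slab_estimates {n : ℕ} {I P A B N : ℕ → ℝ} {s κ X Y : ℝ} (hs : 0 < s)
    (hI : ∀ j < n + 1, 0 ≤ I j) (hN : ∀ j < n + 1, 0 ≤ N j)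
    (h : ∀ j < n + 1, s ^ 2 * κ * I j + s * A j ≤ κ⁻¹ * P j + s * B j + s * X)
    (hNA : ∀ j < n + 1, N j ≤ A j) (hBA : ∀ j < n, B j ≤ A (j + 1) / 2) (hBn : B n ≤ Y) :
    min κ (1 / 2) * (s ^ 2 * ∑ j ∈ Finset.range (n + 1), I j +
        s * ∑ j ∈ Finset.range (n + 1), N j) ≤
      κ⁻¹ * (∑ j ∈ Finset.range (n + 1), P j) + s * ((n + 1 : ℕ) * X) + s * Y := by
  have h1 : s ^ 2 * κ * (∑ j ∈ Finset.range (n + 1), I j) + s * ∑ j ∈ Finset.range (n + 1), A j ≤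
      κ⁻¹ * (∑ j ∈ Finset.range (n + 1), P j) + s * (∑ j ∈ Finset.range (n + 1), B j)
        + s * ((n + 1 : ℕ) * X) := by
    have := Finset.sum_le_sum fun j hj => h j (Finset.mem_range.1 hj)
    simp only [Finset.sum_add_distrib, ← Finset.mul_sum, Finset.sum_const, Finset.card_range,
      nsmul_eq_mul] at this
    linarith
  -- Each `B j` with `j < n` is charged to half of `A (j + 1)`. The unused `A 0` is nonnegative, and
  -- the last `B n` goes into `Y`. Half of the sum of the `A j` stays on the left.
  have h2 : ∑ j ∈ Finset.range (n + 1), B j ≤ (∑ j ∈ Finset.range (n + 1), A j) / 2 + Y := by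
    rw [Finset.sum_range_succ, Finset.sum_range_succ' A, add_div, Finset.sum_div]
    have h3 := Finset.sum_le_sum fun j hj => hBA j (Finset.mem_range.1 hj)
    have h4 : 0 ≤ A 0 := (hN 0 (by omega)).trans (hNA 0 (by omega))
    linarith
  have h3 : ∑ j ∈ Finset.range (n + 1), N j ≤ ∑ j ∈ Finset.range (n + 1), A j :=
    Finset.sum_le_sum fun j hj => hNA j (Finset.mem_range.1 hj)
  have h4 : 0 ≤ ∑ j ∈ Finset.range (n + 1), I j :=
    Finset.sum_nonneg fun j hj => hI j (Finset.mem_range.1 hj)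
  have h5 : 0 ≤ ∑ j ∈ Finset.range (n + 1), N j :=
    Finset.sum_nonneg fun j hj => hN j (Finset.mem_range.1 hj)
  have h6 : min κ (1 / 2) * (s ^ 2 * ∑ j ∈ Finset.range (n + 1), I j) ≤
      κ * (s ^ 2 * ∑ j ∈ Finset.range (n + 1), I j) :=
    mul_le_mul_of_nonneg_right (min_le_left _ _) (by positivity)
  have h7 : min κ (1 / 2) * (s * ∑ j ∈ Finset.range (n + 1), N j) ≤
      1 / 2 * (s * ∑ j ∈ Finset.range (n + 1), N j) :=
    mul_le_mul_of_nonneg_right (min_le_right _ _) (by positivity)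
  have h8 := mul_le_mul_of_nonneg_left h2 hs.le
  have h9 := mul_le_mul_of_nonneg_left h3 hs.le
  rw [mul_add]
  linarith

/-- The weight jumps up by at least `r²` at `t_{j+1}`, since `(y + r)² ≥ y² + r²` and the decay `-β
(t_{j+1} - t_j)` only lowers the left side. With `s r² > 1` the exponents differ by more than `1`,
and `e ≥ 2`. -/
theorem two_mul_exp_weightPiece_le {d : ℕ} {Ω : Set (RSpace d)} {T S r : ℝ} {H : ℝ → RSpace d}
    {m : ℕ} {t : ℕ → ℝ} (hΩ : IsSmoothBoundedDomain Ω) (hzero : (0 : RSpace d) ∈ closure Ω)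
    (hH0 : 0 < minSpeed T H) (hS : S ∈ Ioo (1 / Real.sqrt 2) 1) (hr : 0 < r)
    (ht : IsTimePartition T m t) {j : ℕ} (hj : j + 1 ≤ m) {x : RSpace d} (hx : x ∈ closure Ω)
    {s : ℝ} (hs : 1 / r ^ 2 < s) :
    2 * Real.exp (2 * s * weightPiece Ω T S r H t j (x, t (j + 1))) ≤
      Real.exp (2 * s * weightPiece Ω T S r H t (j + 1) (x, t (j + 1))) := by
  have h1 := norm_sub_pole_add_le hΩ hzero hH0 hS hr ht hj hx
  set y := ‖x - pole Ω S r H t j‖ with hy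
  have hy0 : 0 ≤ y := norm_nonneg _
  have hs0 : 0 < s := lt_trans (by positivity) hs
  have hsr : 1 < s * r ^ 2 := by rwa [div_lt_iff₀ (by positivity)] at hs
  have hβ := decayRate_nonneg (Ω := Ω) (r := r) (t := t) hH0 hS
  have hlt := ht.lt_succ j hj
  have h2 : weightPiece Ω T S r H t j (x, t (j + 1)) ≤ y ^ 2 := by
    simp only [weightPiece]
    nlinarith [mul_nonneg hβ (sub_nonneg.2 hlt.le)]
  have h3 : y ^ 2 + r ^ 2 ≤ weightPiece Ω T S r H t (j + 1) (x, t (j + 1)) := by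
    simp only [weightPiece, sub_self, mul_zero, zero_add]
    nlinarith
  have h4 : 2 * s * weightPiece Ω T S r H t j (x, t (j + 1)) + 1 ≤
      2 * s * weightPiece Ω T S r H t (j + 1) (x, t (j + 1)) := by
    nlinarith
  refine le_trans ?_ (Real.exp_le_exp.2 h4)
  rw [Real.exp_add, mul_comm]
  refine mul_le_mul_of_nonneg_left ?_ (Real.exp_pos _).le
  linarith [Real.add_one_le_exp 1]

theorem exists_weightPiece_le {d : ℕ} {Ω : Set (RSpace d)} (hb : Bornology.IsBounded Ω)
    (T S r : ℝ) (H : ℝ → RSpace d) (m : ℕ) (t : ℕ → ℝ) :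
    ∃ D : ℝ, 0 ≤ D ∧ ∀ j < m, ∀ z ∈ closure Ω ×ˢ Icc 0 T, weightPiece Ω T S r H t j z ≤ D := by
  have hc : Continuous fun z => ∑ j ∈ Finset.range m, |weightPiece Ω T S r H t j z| :=
    continuous_finsetSum _ fun j _ => (contDiff_slabWeight (n := 1) (decayRate Ω T S r H t)
      (t j) (pole Ω S r H t j)).continuous.abs
  obtain ⟨D, hD⟩ := ((hb.isCompact_closure.prod (isCompact_Icc (a := 0) (b := T))).image
    hc).isBounded.exists_norm_le
  refine ⟨|D|, abs_nonneg D, fun j hj z hz => ?_⟩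
  calc weightPiece Ω T S r H t j z ≤ |weightPiece Ω T S r H t j z| := le_abs_self _
    _ ≤ ∑ j ∈ Finset.range m, |weightPiece Ω T S r H t j z| :=
        Finset.single_le_sum (f := fun j => |weightPiece Ω T S r H t j z|)
          (fun i _ => abs_nonneg _) (Finset.mem_range.2 hj)
    _ ≤ D := (le_abs_self _).trans (hD _ ⟨z, hz, rfl⟩)
    _ ≤ |D| := le_abs_self D

end

/-! ### The Carleman estimate -/

theorem theorem1p5 {d : ℕ} (Ω : Set (RSpace d)) (hΩ : IsSmoothBoundedDomain Ω)
    (hzero : (0 : RSpace d) ∈ closure Ω)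
    (T : ℝ) (hT : 0 < T)
    (H : ℝ → RSpace d) (hH : ContDiffOn ℝ 1 H (Icc 0 T)) (hH0 : 0 < minSpeed T H)
    (S : ℝ) (hS : S ∈ Ioo (1 / Real.sqrt 2) 1) (r : ℝ) (hr : 0 < r)
    (m : ℕ) (t : ℕ → ℝ) (ht : IsTimePartition T m t)
    (hcone : ∀ j < m, ∀ τ ∈ Icc (t j) (t (j + 1)),
      S ≤ inner ℝ (direction (H τ)) (direction (H (t j)))) :
    ∃ s₀ C₀ C : ℝ, 0 < s₀ ∧ 0 < C₀ ∧ 0 < C ∧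
      ∀ (u ut : RSpace d × ℝ → ℝ) (Du : RSpace d × ℝ → RSpace d),
        IsH1WithDerivs (spaceTimeCylinder Ω T) u ut Du →
      ∀ g : RSpace d × ℝ → ℝ, IsLateralTrace Ω T u ut Du g →
      ∀ U : ℝ → Lp ℝ 2 ((volume : Measure (RSpace d)).restrict Ω), IsTimeSlices Ω T u U →
      ∀ s : ℝ, s₀ < s →
        s ^ 2 * (∫ z in spaceTimeCylinder Ω T, u z ^ 2 * Real.exp (2 * s * weight Ω T S r H m t z))
          + s * Real.exp (-C₀ * s) * ∑ j ∈ Finset.range m, ∫ x in Ω, (U (t j) x) ^ 2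
        ≤ C * (∫ z in spaceTimeCylinder Ω T,
              transportOp H ut Du z ^ 2 * Real.exp (2 * s * weight Ω T S r H m t z))
          + C * s * Real.exp (C * s) *
              (∫ z in exitBoundary Ω T H, g z ^ 2 ∂(lateralMeasure Ω T))
          + C * s * Real.exp (C * s) * ∫ x in Ω, (U T x) ^ 2 := by
  have hd := one_le_dim_of_minSpeed_pos hT hH0
  obtain ⟨hS0, hS2⟩ := half_lt_sq_of_mem_Ioo hS
  have hbd := hΩ.isBounded
  have hHc : ContinuousOn H (Icc 0 T) := hH.continuousOn
  obtain ⟨M, hM⟩ := (isCompact_Icc.image_of_continuousOn hHc).isBounded.exists_norm_le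
  have hM : ∀ τ ∈ Icc 0 T, ‖H τ‖ ≤ M := fun τ hτ => hM _ ⟨τ, hτ, rfl⟩
  have hM0 : 0 ≤ M := (norm_nonneg _).trans (hM 0 (left_mem_Icc.2 hT.le))
  obtain ⟨K, hK0, hK⟩ := exists_integral_fderiv_le_exitSlice hd hΩ
  obtain ⟨D, hD0, hD⟩ := exists_weightPiece_le hbd T S r H m t
  set κ := weightSlope (Metric.diam Ω) S (minSpeed T H) with hκdef
  have hκ : 0 < κ := weightSlope_pos (hΩ.diam_pos hd) hH0 hS2 hS0 hS.2
  set c := min κ (1 / 2) with hc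
  have hc0 : 0 < c := lt_min hκ (by norm_num)
  obtain ⟨n, rfl⟩ : ∃ n, m = n + 1 := by
    refine Nat.exists_eq_succ_of_ne_zero fun h0 => ?_
    have h1 := ht.last
    rw [h0, ht.zero] at h1
    exact hT.ne h1
  -- The first three summands are the coefficients of the source, exit and final-time terms after
  -- division by `c`. The last, `2 * D`, dominates the exponent, as every `φ_j` is at most `D`.
  set C := κ⁻¹ / c + (n + 1 : ℕ) * (K * M) / c + 1 / c + 2 * D with hC
  have hC1 : 0 ≤ κ⁻¹ / c := by positivity
  have hC2 : 0 ≤ (n + 1 : ℕ) * (K * M) / c := by positivity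
  have hC3 : 0 < 1 / c := by positivity
  -- The threshold `1 / r²` is what absorption between consecutive slabs requires. The slices `U (t
  -- j)` are in fact controlled without an exponential factor, so `C₀ = 1` serves.
  refine ⟨1 / r ^ 2, 1, C, by positivity, one_pos, by positivity, ?_⟩
  intro u ut Du hu g hg U hU s hs
  have hs0 : 0 < s := lt_trans (by positivity) hs
  have hQm : MeasurableSet Ω := hΩ.isOpen.measurableSet
  -- integrability of the weighted squares
  have hwc : ∀ j, Continuous fun z => Real.exp (2 * s * weightPiece Ω T S r H t j z) := fun j =>
    Real.continuous_exp.comp (continuous_const.mul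
      (contDiff_slabWeight (n := 1) (decayRate Ω T S r H t) (t j) (pole Ω S r H t j)).continuous)
  have hwle : ∀ j < n + 1, ∀ z ∈ closure Ω ×ˢ Icc 0 T,
      Real.exp (2 * s * weightPiece Ω T S r H t j z) ≤ Real.exp (2 * s * D) := fun j hj z hz =>
    Real.exp_le_exp.2 (mul_le_mul_of_nonneg_left (hD j hj z hz) (by positivity))
  have hsub : ∀ j < n + 1, Ω ×ˢ Ioo (t j) (t (j + 1)) ⊆ spaceTimeCylinder Ω T := fun j hj =>
    prod_mono le_rfl (Ioo_subset_Ioo (ht.mem_Icc hj.le).1 (ht.mem_Icc (j := j + 1) hj).2)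
  have hslabm : ∀ j, MeasurableSet (Ω ×ˢ Ioo (t j) (t (j + 1))) := fun j =>
    hQm.prod measurableSet_Ioo
  have hW : ∀ f : RSpace d × ℝ → ℝ, ∀ j < n + 1, ∀ z ∈ Ω ×ˢ Ioo (t j) (t (j + 1)),
      f z ^ 2 * Real.exp (2 * s * weightPiece Ω T S r H t j z) =
        f z ^ 2 * Real.exp (2 * s * weight Ω T S r H (n + 1) t z) := fun f j hj z hz => by
    rw [weight_eq_weightPiece ht hj (Ioo_subset_Ico_self hz.2)]
  have hdecomp : ∀ f : RSpace d × ℝ → ℝ,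
      MemLp f 2 (volume.restrict (spaceTimeCylinder Ω T)) →
      ∫ z in spaceTimeCylinder Ω T, f z ^ 2 * Real.exp (2 * s * weight Ω T S r H (n + 1) t z) =
        ∑ j ∈ Finset.range (n + 1), ∫ z in Ω ×ˢ Ioo (t j) (t (j + 1)),
          f z ^ 2 * Real.exp (2 * s * weightPiece Ω T S r H t j z) := by
    intro f hf
    have hi : ∀ j < n + 1, IntegrableOn
        (fun z => f z ^ 2 * Real.exp (2 * s * weight Ω T S r H (n + 1) t z))
        (Ω ×ˢ Ioo (t j) (t (j + 1))) := fun j hj => by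
      refine IntegrableOn.congr_fun ?_ (hW f j hj) (hslabm j)
      refine integrable_sq_mul (hf.mono_measure (Measure.restrict_mono (hsub j hj) le_rfl))
        (hwc j).aestronglyMeasurable (fun z => (Real.exp_pos _).le) (C := Real.exp (2 * s * D)) ?_
      exact ae_restrict_of_forall_mem (hslabm j) fun z hz => hwle j hj z
        ⟨subset_closure hz.1, Ioo_subset_Icc_self (hsub j hj hz).2⟩
    rw [ht.integral_cylinder_eq_sum hΩ.isOpen hi]
    exact Finset.sum_congr rfl fun j hj => setIntegral_congr_fun (hslabm j)
      fun z hz => (hW f j (Finset.mem_range.1 hj) z hz).symm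
  have hUi : ∀ j < n + 1, ∀ τ ∈ Icc 0 T, IntegrableOn
      (fun x => U τ x ^ 2 * Real.exp (2 * s * weightPiece Ω T S r H t j (x, τ))) Ω :=
    fun j hj τ hτ => integrable_sq_mul (Lp.memLp (U τ))
      ((hwc j).comp (by fun_prop : Continuous fun x : RSpace d => (x, τ))).aestronglyMeasurable
      (fun z => (Real.exp_pos _).le) (C := Real.exp (2 * s * D))
      (ae_restrict_of_forall_mem hQm fun x hx => hwle j hj _ ⟨subset_closure hx, hτ⟩)
  have hUsq : ∀ τ, IntegrableOn (fun x => U τ x ^ 2) Ω := fun τ => (Lp.memLp (U τ)).integrable_sq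
  -- the slab estimates
  set E := ∫ z in exitBoundary Ω T H, g z ^ 2 ∂(lateralMeasure Ω T) with hE
  have hE0 : 0 ≤ E := integral_nonneg fun z => sq_nonneg _
  have hexit : ∀ j < n + 1, ∫ z in exitSlab Ω T H (t j) (t (j + 1)), g z ^ 2 *
      Real.exp (2 * s * weightPiece Ω T S r H t j z) ∂(lateralMeasure Ω T) ≤
      Real.exp (2 * s * D) * E := by
    intro j hj
    have hgi : Integrable (fun z => g z ^ 2) (lateralMeasure Ω T) := hg.1.integrable_sq
    have hae : ∀ᵐ z ∂(lateralMeasure Ω T),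
        Real.exp (2 * s * weightPiece Ω T S r H t j z) ≤ Real.exp (2 * s * D) := by
      filter_upwards [ae_lateralMeasure_mem hΩ T] with z hz using hwle j hj z hz
    calc _ ≤ ∫ z in exitSlab Ω T H (t j) (t (j + 1)), Real.exp (2 * s * D) * g z ^ 2
          ∂(lateralMeasure Ω T) := by
          refine integral_mono_ae (integrable_sq_mul hg.1 (hwc j).aestronglyMeasurable
            (fun z => (Real.exp_pos _).le) hae).integrableOn (hgi.const_mul _).integrableOn
            (ae_restrict_of_ae ?_)
          filter_upwards [hae] with z hz
          rw [mul_comm]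
          exact mul_le_mul_of_nonneg_right hz (sq_nonneg _)
      _ = Real.exp (2 * s * D) * ∫ z in exitSlab Ω T H (t j) (t (j + 1)), g z ^ 2
          ∂(lateralMeasure Ω T) := integral_const_mul _ _
      _ ≤ Real.exp (2 * s * D) * E := mul_le_mul_of_nonneg_left
          (setIntegral_mono_set hgi.integrableOn (Eventually.of_forall fun z => sq_nonneg _)
            (LE.le.eventuallyLE inter_subset_left)) (Real.exp_pos _).le
  have hslab : ∀ j < n + 1, s ^ 2 * κ * (∫ z in Ω ×ˢ Ioo (t j) (t (j + 1)),
        u z ^ 2 * Real.exp (2 * s * weightPiece Ω T S r H t j z))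
      + s * ∫ x in Ω, U (t j) x ^ 2 * Real.exp (2 * s * weightPiece Ω T S r H t j (x, t j)) ≤
      κ⁻¹ * (∫ z in Ω ×ˢ Ioo (t j) (t (j + 1)), transportOp H ut Du z ^ 2 *
          Real.exp (2 * s * weightPiece Ω T S r H t j z))
        + s * (∫ x in Ω, U (t (j + 1)) x ^ 2 *
            Real.exp (2 * s * weightPiece Ω T S r H t j (x, t (j + 1))))
        + s * (K * M * (Real.exp (2 * s * D) * E)) := by
    intro j hj
    refine (slab_estimate hΩ hT hHc hK0 hK hM (ht.mem_Icc hj.le).1 (ht.lt_succ j hj).le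
      (ht.mem_Icc (j := j + 1) hj).2 hκ (fun τ hτ x hx => weightSlope_le hΩ hzero hH0 hS hr ht hd
        hcone hj hτ hx) hu hg hU hs0).trans ?_
    exact add_le_add le_rfl (mul_le_mul_of_nonneg_left (mul_le_mul_of_nonneg_left (hexit j hj)
      (by positivity)) hs0.le)
  have hfinal := sum_slab_estimates (N := fun j => ∫ x in Ω, U (t j) x ^ 2)
    (Y := Real.exp (2 * s * D) * ∫ x in Ω, U T x ^ 2) hs0
    (fun j _ => integral_nonneg fun z => mul_nonneg (sq_nonneg _) (Real.exp_pos _).le)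
    (fun j _ => integral_nonneg fun z => sq_nonneg _) hslab
    -- At its own initial time `φ_j` is `|x - x_j|² ≥ 0`, so the exponential weight is at least `1`
    -- and may be dropped.
    (fun j hj => by
      refine integral_mono (hUsq _) (hUi j hj _ (ht.mem_Icc hj.le)) fun x => ?_
      refine le_mul_of_one_le_right (sq_nonneg _) (Real.one_le_exp ?_)
      simp only [weightPiece, sub_self, mul_zero, zero_add]
      positivity)
    (fun j hj => by
      rw [← integral_div]
      refine setIntegral_mono_on (hUi j (by omega) _ (ht.mem_Icc (by omega)))
        ((hUi (j + 1) (by omega) _ (ht.mem_Icc (by omega))).div_const 2) hQm fun x hx => ?_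
      have h1 := two_mul_exp_weightPiece_le hΩ hzero hH0 hS hr ht (j := j) (by omega)
        (subset_closure hx) hs
      rw [mul_div_assoc]
      exact mul_le_mul_of_nonneg_left (by linarith) (sq_nonneg _))
    (by
      rw [ht.last, ← integral_const_mul]
      refine setIntegral_mono_on (hUi n (by omega) _ (right_mem_Icc.2 hT.le))
        ((hUsq T).const_mul _) hQm fun x hx => ?_
      rw [mul_comm]
      exact mul_le_mul_of_nonneg_right
        (hwle n (by omega) _ ⟨subset_closure hx, right_mem_Icc.2 hT.le⟩) (sq_nonneg _))
  rw [hdecomp u hu.memLp, hdecomp _ (memLp_transportOp hΩ.isOpen hHc hM hu.memLp_time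
    hu.memLp_space)]
  set I := ∑ j ∈ Finset.range (n + 1), ∫ z in Ω ×ˢ Ioo (t j) (t (j + 1)),
    u z ^ 2 * Real.exp (2 * s * weightPiece Ω T S r H t j z)
  set P := ∑ j ∈ Finset.range (n + 1), ∫ z in Ω ×ˢ Ioo (t j) (t (j + 1)),
    transportOp H ut Du z ^ 2 * Real.exp (2 * s * weightPiece Ω T S r H t j z) with hP
  have hP0 : 0 ≤ P := Finset.sum_nonneg fun j _ => integral_nonneg fun z =>
    mul_nonneg (sq_nonneg _) (Real.exp_pos _).le
  set N := ∑ j ∈ Finset.range (n + 1), ∫ x in Ω, U (t j) x ^ 2 with hN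
  have hN0 : 0 ≤ N := Finset.sum_nonneg fun j _ => integral_nonneg fun z => sq_nonneg _
  set Z := ∫ x in Ω, U T x ^ 2
  have hZ0 : 0 ≤ Z := integral_nonneg fun z => sq_nonneg _
  have hexp1 : Real.exp (-1 * s) ≤ 1 := Real.exp_le_one_iff.2 (by linarith)
  have hexp2 : Real.exp (2 * s * D) ≤ Real.exp (C * s) := by
    refine Real.exp_le_exp.2 ?_
    have : 2 * D ≤ C := by rw [hC]; linarith
    nlinarith
  have g1 : s * Real.exp (-1 * s) * N ≤ s * N :=
    mul_le_mul_of_nonneg_right (mul_le_of_le_one_right hs0.le hexp1) hN0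
  have g2 : s ^ 2 * I + s * N ≤ κ⁻¹ / c * P +
      (n + 1 : ℕ) * (K * M) / c * s * Real.exp (2 * s * D) * E +
      1 / c * s * Real.exp (2 * s * D) * Z := by
    rw [← mul_le_mul_iff_right₀ hc0]
    refine hfinal.trans (le_of_eq ?_)
    field_simp
  have g3 : κ⁻¹ / c * P ≤ C * P := mul_le_mul_of_nonneg_right (by rw [hC]; linarith) hP0
  have g4 : (n + 1 : ℕ) * (K * M) / c * s * Real.exp (2 * s * D) * E ≤
      C * s * Real.exp (C * s) * E := by
    have : (n + 1 : ℕ) * (K * M) / c ≤ C := by rw [hC]; linarith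
    gcongr
  have g5 : 1 / c * s * Real.exp (2 * s * D) * Z ≤ C * s * Real.exp (C * s) * Z := by
    have : 1 / c ≤ C := by rw [hC]; linarith
    gcongr
  linarith
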